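/- Identify $\mathbb{C}^4$ with $\mathbb{H}^2$ via $(z_0,z_1,z_2,z_3)\mapsto(z_0+z_1j,\,z_2+z_3j)$, and let $\pi:S^7\to\mathbb{C}P^3$ be the Hopf fibration $p\mapsto[p]$ (quotient by left multiplication with unit complex numbers). Let $g_1$ be the Fubini--Study metric on $\mathbb{C}P^3$, for which $\pi$ is a Riemannian submersion from the round sphere, and let $J_1$ be the complex structure induced by multiplication by $i$. Let $\mathcal{D}_1=d\pi(\operatorname{span}\{jp,kp\})$ and $\mathcal{D}_2=d\pi(\{p,ip,jp,kp\}^{\perp})$; these are well-defined distributions with $T\mathbb{C}P^3=\mathcal{D}_1\oplus\mathcal{D}_2$. Let $P$ be the identity on $\mathcal{D}_2$ and minus the identity on $\mathcal{D}_1$, and put $J=PJ_1$ and $g(X,Y)=\tfrac32 g_1(X,Y)+\tfrac12 g_1(X,PY)$, so that $(\mathbb{C}P^3,g,J)$ is the nearly Kähler $\mathbb{C}P^3$. Let $\tau:\mathbb{C}P^3\to S^4\cong\mathbb{H}P^1$ be the twistor fibration, induced by $(p,q)\mapsto(|p|^2-|q|^2,\,2\bar p q)/(|p|^2+|q|^2)\in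 S^4\subset\mathbb{R}\oplus\mathbb{H}$ for $(p,q)\in\mathbb{H}^2\setminus\{0\}$. Let $f:\mathcal{H}\to\mathbb{C}P^3$ be a smooth immersed hypersurface, $T\mathcal{H}\subset T\mathbb{C}P^3$ its tangent spaces and $N$ a ($g$-)unit normal, which is determined up to sign at each point. Its angle $\theta\in[0,\pi/2]$ is defined by $\cos(2\theta)=g(N,PN)$, and $\mathcal{H}$ is called horizontal if $\theta$ is identically zero. Then the following are equivalent: 1. $\mathcal{H}$ is horizontal; 2. $\operatorname{span}\{N,JN,J_1N,PN\}$ is two-dimensional at every point of $\mathcal{H}$; 3. $\mathcal{H}$ is $P$-invariant, i.e. the distribution $\operatorname{span}\{JN\}^{\perp}\cap T\mathcal{H}$ is preserved by $P$; 4. the distribution $\operatorname{span}\{JN\}\cap T\mathcal{H}$ is preserved by $P$; 5. $\mathcal{H}$ is locally the pre-image under $\tau$ of a hypersurface of $S^4$: every point of $\mathcal{H}$ has an open neighbourhood $U$ such that $f(U)$ is an open subset of $\tau^{-1}(M)$ for some embedded hypersurface $M$ of $S^4$. Moreover, if $f(\mathcal{H})=\tau^{-1}(M)$ for an embedded hypersurface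 $M$ of $S^4$, then $\mathcal{H}$ is horizontal. Conversely, if $\mathcal{H}$ is horizontal, $f$ is an embedding, and $f(\mathcal{H})$ meets every fibre of $\tau$ in a closed set (for instance if $f(\mathcal{H})$ is closed in $\mathbb{C}P^3$), then $f(\mathcal{H})=\tau^{-1}(M)$ for some embedded hypersurface $M$ of $S^4$. -/

import Mathlib

open Set Function Module
open scoped Manifold ContDiff InnerProductSpace Quaternion Topology

noncomputable section

namespace NKCP3

/-! ### `ℂP³` as a smooth manifold -/

/-- `ℂ⁴` with its Hermitian inner product; its real inner product is the real part of this. -/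
abbrev C4 : Type := EuclideanSpace ℂ (Fin 4)

/-- The model space of `ℂP³`. -/
abbrev C3 : Type := Fin 3 → ℂ

/-- Complex projective three-space. -/
abbrev CP3 : Type := Projectivization ℂ C4

/-- The quotient topology. -/
instance instTopologicalSpaceCP3 : TopologicalSpace CP3 :=
  inferInstanceAs (TopologicalSpace (Quotient (projectivizationSetoid ℂ C4)))

/-- The affine coordinates `z ↦ (z_k / z_i)_{k ≠ i}` on vectors. -/
def affine (i : Fin 4) (v : C4) : C3 := fun k => v (i.succAbove k) / v i

/-- The inverse of affine coordinates: insert `1` in position `i`. -/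
def unaffine (i : Fin 4) (w : C3) : C4 := WithLp.toLp 2 (i.insertNth (1 : ℂ) w)

@[simp] lemma unaffine_same (i : Fin 4) (w : C3) : unaffine i w i = 1 := by
  simp [unaffine]

@[simp] lemma unaffine_succAbove (i : Fin 4) (w : C3) (k : Fin 3) :
    unaffine i w (i.succAbove k) = w k := by
  simp [unaffine]

lemma unaffine_ne_zero (i : Fin 4) (w : C3) : unaffine i w ≠ 0 := by
  intro h
  have := unaffine_same i w
  rw [h] at this
  simp at this

lemma affine_unaffine (i : Fin 4) (w : C3) : affine i (unaffine i w) = w := by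
  ext k; simp [affine]

lemma unaffine_affine (i : Fin 4) (v : C4) (h : v i ≠ 0) :
    unaffine i (affine i v) = (v i)⁻¹ • v := by
  ext k
  rcases Fin.eq_self_or_eq_succAbove i k with rfl | ⟨l, rfl⟩
  · simp [h]
  · simp [affine, div_eq_inv_mul]

lemma affine_smul (i : Fin 4) (c : ℂ) (hc : c ≠ 0) (v : C4) : affine i (c • v) = affine i v := by
  ext k
  simp [affine, mul_div_mul_left _ _ hc]

lemma contDiff_unaffine (i : Fin 4) : ContDiff ℝ ∞ (unaffine i) := by
  unfold unaffine
  refine (PiLp.contDiff_toLp (𝕜 := ℝ) (p := 2) (E := fun _ : Fin 4 => ℂ)).comp ?_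
  rw [contDiff_pi]
  intro k
  rcases Fin.eq_self_or_eq_succAbove i k with rfl | ⟨l, rfl⟩
  · simpa using contDiff_const
  · simpa using contDiff_apply ℝ ℂ l

lemma contDiff_coord (i : Fin 4) : ContDiff ℝ ∞ (fun v : C4 => v i) :=
  ((EuclideanSpace.proj (𝕜 := ℂ) i : C4 →L[ℂ] ℂ).restrictScalars ℝ).contDiff

lemma contDiffOn_affine (i : Fin 4) : ContDiffOn ℝ ∞ (affine i) {v | v i ≠ 0} := by
  rw [contDiffOn_pi]
  intro k
  have h1 : ContDiffOn ℝ ∞ (fun v : C4 => v (i.succAbove k)) {v | v i ≠ 0} :=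
    (contDiff_coord _).contDiffOn
  have h2 : ContDiffOn ℝ ∞ (fun v : C4 => v i) {v | v i ≠ 0} := (contDiff_coord _).contDiffOn
  have h3 : ∀ v ∈ {v : C4 | v i ≠ 0}, v i ≠ 0 := fun v hv => hv
  have h4 : ContDiffOn ℝ ∞ (fun v : C4 => (v i)⁻¹) {v | v i ≠ 0} := h2.inv h3
  have h5 : ContDiffOn ℝ ∞ (fun v : C4 => v (i.succAbove k) * (v i)⁻¹) {v | v i ≠ 0} := h1.mul h4
  exact h5.congr (fun v _ => div_eq_mul_inv _ _)

lemma isOpen_coord_ne (i : Fin 4) : IsOpen {v : C4 | v i ≠ 0} :=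
  isOpen_ne_fun (contDiff_coord i).continuous continuous_const

/-- The points of `ℂP³` whose `i`-th homogeneous coordinate does not vanish. -/
def affineDomain (i : Fin 4) : Set CP3 :=
  {x | Projectivization.lift (fun v : {v : C4 // v ≠ 0} => v.1 i ≠ 0)
    (by
      rintro ⟨a, ha⟩ ⟨b, hb⟩ t rfl
      have ht : t ≠ 0 := by rintro rfl; simp at ha
      simp [ht]) x}

/-- Affine coordinates on `ℂP³`. -/
def affineCoord (i : Fin 4) (x : CP3) : C3 :=
  Projectivization.lift (fun v : {v : C4 // v ≠ 0} => affine i v.1)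
    (by
      rintro ⟨a, ha⟩ ⟨b, hb⟩ t rfl
      have ht : t ≠ 0 := by rintro rfl; simp at ha
      exact affine_smul i t ht b) x

@[simp] lemma mk_mem_affineDomain (i : Fin 4) (v : C4) (hv : v ≠ 0) :
    Projectivization.mk ℂ v hv ∈ affineDomain i ↔ v i ≠ 0 := Iff.rfl

@[simp] lemma affineCoord_mk (i : Fin 4) (v : C4) (hv : v ≠ 0) :
    affineCoord i (Projectivization.mk ℂ v hv) = affine i v := rfl

lemma isOpen_affineDomain (i : Fin 4) : IsOpen (affineDomain i) :=
  isOpen_coinduced.2 ((isOpen_coord_ne i).preimage continuous_subtype_val)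

lemma continuous_mk' : Continuous (Projectivization.mk' ℂ : {v : C4 // v ≠ 0} → CP3) :=
  continuous_quotient_mk'

lemma isQuotientMap_mk' :
    Topology.IsQuotientMap (Projectivization.mk' ℂ : {v : C4 // v ≠ 0} → CP3) :=
  isQuotientMap_quotient_mk'

/-- The affine chart of `ℂP³` with index `i`. -/
def affineChart (i : Fin 4) : OpenPartialHomeomorph CP3 C3 where
  toFun := affineCoord i
  invFun w := Projectivization.mk ℂ (unaffine i w) (unaffine_ne_zero i w)
  source := affineDomain i
  target := univ
  map_source' _ _ := mem_univ _
  map_target' w _ := by simp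
  left_inv' x hx := by
    induction x using Projectivization.ind with
    | h v hv =>
      rw [mk_mem_affineDomain] at hx
      rw [Projectivization.mk_eq_mk_iff']
      exact ⟨(v i)⁻¹, by rw [affineCoord_mk, unaffine_affine i v hx]⟩
  right_inv' w _ := by simp [affine_unaffine]
  open_source := isOpen_affineDomain i
  open_target := isOpen_univ
  continuousOn_toFun := by
    rw [isQuotientMap_mk'.continuousOn_isOpen_iff (isOpen_affineDomain i)]
    exact (contDiffOn_affine i).continuousOn.comp continuous_subtype_val.continuousOn
      (fun v hv => hv)
  continuousOn_invFun :=
    (continuous_mk'.comp ((contDiff_unaffine i).continuous.subtype_mk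
      (unaffine_ne_zero i))).continuousOn

lemma exists_mem_affineDomain (x : CP3) : ∃ i, x ∈ affineDomain i := by
  induction x using Projectivization.ind with
  | h v hv =>
    by_contra! h
    apply hv
    ext i
    simpa using h i

instance instChartedSpaceCP3 : ChartedSpace C3 CP3 where
  atlas := range affineChart
  chartAt x := affineChart (exists_mem_affineDomain x).choose
  mem_chart_source x := (exists_mem_affineDomain x).choose_spec
  chart_mem_atlas _ := mem_range_self _

/-- `ℂP³` is a smooth (real) manifold. -/
instance instIsManifoldCP3 : IsManifold 𝓘(ℝ, C3) ∞ CP3 := by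
  apply isManifold_of_contDiffOn
  rintro _ _ ⟨i, rfl⟩ ⟨j, rfl⟩
  have h := (contDiffOn_affine j).comp (contDiff_unaffine i).contDiffOn
    (s := {w : C3 | unaffine i w j ≠ 0}) (fun w hw => hw)
  refine (h.mono ?_).congr ?_
  · intro w hw
    simpa [affineChart] using hw
  · intro w hw
    rfl

/-- The projection `ℂ⁴ ∖ {0} → ℂP³`, with an irrelevant value at `0`. On the unit sphere `S⁷` this
is the Hopf fibration. -/
def proj (v : C4) : CP3 := by
  classical
  exact if h : v ≠ 0 then Projectivization.mk ℂ v h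
    else Projectivization.mk ℂ (unaffine 0 0) (unaffine_ne_zero 0 0)

lemma proj_of_ne {v : C4} (h : v ≠ 0) : proj v = Projectivization.mk ℂ v h := by
  simp [proj, h]

lemma exists_proj_eq_affineChart (p : C4) (hp : p ≠ 0) :
    ∃ i, chartAt C3 (proj p) = affineChart i ∧ p i ≠ 0 := by
  refine ⟨(exists_mem_affineDomain (proj p)).choose, rfl, ?_⟩
  have h := (exists_mem_affineDomain (proj p)).choose_spec
  generalize (exists_mem_affineDomain (proj p)).choose = i at h
  rwa [proj_of_ne hp, mk_mem_affineDomain] at h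

lemma continuousAt_proj (p : C4) (hp : p ≠ 0) : ContinuousAt proj p := by
  have h : ContinuousOn proj {v : C4 | v ≠ 0} := by
    rw [continuousOn_iff_continuous_domRestrict]
    have : domRestrict {v : C4 | v ≠ 0} proj = Projectivization.mk' ℂ := by
      funext v
      exact proj_of_ne v.2
    rw [this]
    exact continuous_mk'
  exact h.continuousAt (isOpen_ne.mem_nhds hp)

lemma affineChart_proj_eventuallyEq (i : Fin 4) (p : C4) (hp : p i ≠ 0) :
    (affineChart i ∘ proj) =ᶠ[𝓝 p] affine i := by
  filter_upwards [(isOpen_coord_ne i).mem_nhds hp] with v hv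
  have hv0 : v ≠ 0 := by rintro rfl; simp at hv
  rw [comp_apply, proj_of_ne hv0]
  rfl

/-- In the affine chart with index `i`, the differential of the projection is that of the affine
coordinates. -/
lemma exists_hasMFDerivAt_proj (p : C4) (hp : p ≠ 0) :
    ∃ i, p i ≠ 0 ∧ HasMFDerivAt 𝓘(ℝ, C4) 𝓘(ℝ, C3) proj p (fderiv ℝ (affine i) p) := by
  obtain ⟨i, hi, hpi⟩ := exists_proj_eq_affineChart p hp
  refine ⟨i, hpi, continuousAt_proj p hp, ?_⟩
  have h1 : HasFDerivAt (affine i) (fderiv ℝ (affine i) p) p :=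
    (((contDiffOn_affine i).contDiffAt ((isOpen_coord_ne i).mem_nhds hpi)).differentiableAt
      (by simp)).hasFDerivAt
  have h2 := h1.congr_of_eventuallyEq (affineChart_proj_eventuallyEq i p hpi)
  have h3 : writtenInExtChartAt 𝓘(ℝ, C4) 𝓘(ℝ, C3) p proj = affineChart i ∘ proj := by
    ext1 v
    simp only [writtenInExtChartAt, extChartAt, hi]
    rfl
  rw [h3]
  exact h2.hasFDerivWithinAt

lemma fderiv_affine_apply (i : Fin 4) (p : C4) (hp : p i ≠ 0) (v : C4) (k : Fin 3) :
    fderiv ℝ (affine i) p v k =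
      (v (i.succAbove k) * p i - p (i.succAbove k) * v i) / (p i) ^ 2 := by
  have h1 : HasFDerivAt (affine i) (fderiv ℝ (affine i) p) p :=
    (((contDiffOn_affine i).contDiffAt ((isOpen_coord_ne i).mem_nhds hp)).differentiableAt
      (by simp)).hasFDerivAt
  have hline : HasDerivAt (fun t : ℝ => p + t • v) v 0 := by
    simpa using ((hasDerivAt_id (0 : ℝ)).smul_const v).const_add p
  have h1' : HasFDerivAt (affine i) (fderiv ℝ (affine i) p) (p + (0 : ℝ) • v) := by simpa using h1
  have h2 := (hasDerivAt_pi.1 (h1'.comp_hasDerivAt (0 : ℝ) hline)) k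
  have hc : ∀ l : Fin 4, HasDerivAt (fun t : ℝ => (p + t • v) l) (v l) 0 := by
    intro l
    have : HasDerivAt (fun t : ℝ => p l + (t : ℂ) * v l) (v l) 0 := by
      simpa using ((hasDerivAt_id (0 : ℝ)).ofReal_comp.mul_const (v l)).const_add (p l)
    simpa using this
  have h3 := (hc (i.succAbove k)).div (hc i) (by simpa using hp)
  have h4 := h2.unique h3
  simpa using h4

/-! ### The Hopf fibration and the structures on `ℂP³` -/

/-- The horizontal space at `p` of the Hopf fibration: the vectors that are orthogonal to `p` (so
tangent to `S⁷`) and to `i p`, i.e. Hermitian orthogonal to `p`. -/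
def hopfHorizontal (p : C4) : Submodule ℝ C4 := ((ℂ ∙ p)ᗮ).restrictScalars ℝ

/-- The tangent space of `ℂP³` at `x`. -/
abbrev T (x : CP3) : Type := TangentSpace 𝓘(ℝ, C3) x

/-- The differential at `p` of the projection `ℂ⁴ ∖ {0} → ℂP³`. Its values are vectors of
`T (proj p)`; all the spaces `T x` have `C3` as underlying vector space, so that we may forget the
base point. -/
def dproj (p : C4) : C4 →L[ℝ] C3 := mfderiv 𝓘(ℝ, C4) 𝓘(ℝ, C3) proj p

lemma exists_dproj_apply (p : C4) (hp : p ≠ 0) : ∃ i, p i ≠ 0 ∧ ∀ (v : C4) (k : Fin 3),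
    dproj p v k = (v (i.succAbove k) * p i - p (i.succAbove k) * v i) / (p i) ^ 2 := by
  obtain ⟨i, hpi, h⟩ := exists_hasMFDerivAt_proj p hp
  refine ⟨i, hpi, fun v k => ?_⟩
  rw [← fderiv_affine_apply i p hpi, dproj, h.mfderiv]
  rfl

lemma dproj_eq_zero_iff (p : C4) (hp : p ≠ 0) (v : C4) : dproj p v = 0 ↔ v ∈ ℂ ∙ p := by
  obtain ⟨i, hpi, h⟩ := exists_dproj_apply p hp
  rw [Submodule.mem_span_singleton]
  constructor
  · intro hv
    refine ⟨v i / p i, ?_⟩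
    ext k
    rcases Fin.eq_self_or_eq_succAbove i k with rfl | ⟨l, rfl⟩
    · simp [hpi]
    · have h1 := h v l
      rw [hv] at h1
      have h2 : v (i.succAbove l) * p i - p (i.succAbove l) * v i = 0 := by
        have h3 : (0 : ℂ) = (v (i.succAbove l) * p i - p (i.succAbove l) * v i) / (p i) ^ 2 := h1
        rcases div_eq_zero_iff.1 h3.symm with h4 | h4
        · exact h4
        · exact absurd h4 (pow_ne_zero 2 hpi)
      simp only [PiLp.smul_apply, smul_eq_mul]
      field_simp
      linear_combination -h2
  · rintro ⟨c, rfl⟩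
    have : dproj p (c • p) = 0 := by
      ext k
      rw [h]
      simp
      left
      ring
    exact this

/-- The differential of the Hopf fibration is an isomorphism on the horizontal space. -/
lemma bijective_dproj_hopfHorizontal (p : C4) (hp : p ≠ 0) :
    Bijective ((dproj p : C4 →ₗ[ℝ] C3).domRestrict (hopfHorizontal p)) := by
  constructor
  · rw [← LinearMap.ker_eq_bot, LinearMap.ker_eq_bot']
    rintro ⟨v, hv⟩ h
    have h1 : v ∈ ℂ ∙ p := (dproj_eq_zero_iff p hp v).1 h
    have h2 : v ∈ (ℂ ∙ p)ᗮ := hv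
    have : v ∈ (ℂ ∙ p) ⊓ (ℂ ∙ p)ᗮ := ⟨h1, h2⟩
    rw [Submodule.inf_orthogonal_eq_bot] at this
    simpa using this
  · intro X
    obtain ⟨i, hpi, h⟩ := exists_dproj_apply p hp
    let w : C4 := WithLp.toLp 2 (i.insertNth (0 : ℂ) (fun k => X k * p i))
    have hw : dproj p w = X := by
      have : dproj p w = X := by
        ext k
        rw [h]
        simp [w]
        field_simp
      exact this
    let u : C4 := w - (ℂ ∙ p).starProjection w
    have hu : u ∈ (ℂ ∙ p)ᗮ := Submodule.sub_starProjection_mem_orthogonal w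
    refine ⟨⟨u, hu⟩, ?_⟩
    have h0 : dproj p ((ℂ ∙ p).starProjection w) = 0 :=
      (dproj_eq_zero_iff p hp _).2 (Submodule.starProjection_apply_mem _ _)
    change dproj p u = X
    rw [map_sub, h0, hw, sub_zero]

/-- A point of `S⁷` over `x`. -/
def unitRep (x : CP3) : C4 := ((‖x.rep‖⁻¹ : ℝ) : ℂ) • x.rep

lemma norm_unitRep (x : CP3) : ‖unitRep x‖ = 1 := by
  have := norm_ne_zero_iff.2 x.rep_nonzero
  simp [unitRep, norm_smul, this]

lemma unitRep_ne_zero (x : CP3) : unitRep x ≠ 0 := by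
  intro h
  have := norm_unitRep x
  simp [h] at this

lemma proj_unitRep (x : CP3) : proj (unitRep x) = x := by
  rw [proj_of_ne (unitRep_ne_zero x)]
  conv_rhs => rw [← x.mk_rep]
  rw [Projectivization.mk_eq_mk_iff']
  exact ⟨_, rfl⟩

/-- The differential of the Hopf fibration at the point `unitRep x` of `S⁷` over `x`. -/
def dHopf (x : CP3) : C4 →ₗ[ℝ] T x := (dproj (unitRep x) : C4 →ₗ[ℝ] C3)

/-- The differential of the Hopf fibration, as an isomorphism from the horizontal space. -/
def hopfIso (x : CP3) : hopfHorizontal (unitRep x) ≃ₗ[ℝ] T x :=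
  LinearEquiv.ofBijective ((dHopf x).domRestrict (hopfHorizontal (unitRep x)))
    (bijective_dproj_hopfHorizontal (unitRep x) (unitRep_ne_zero x))

/-- The horizontal lift to `unitRep x` of tangent vectors at `x`. -/
def hopfLift (x : CP3) : T x →ₗ[ℝ] C4 :=
  (hopfHorizontal (unitRep x)).subtype ∘ₗ ((hopfIso x).symm : T x →ₗ[ℝ] _)

/-- Left multiplication by `i` on `ℍ² = ℂ⁴`. -/
def iMul : C4 →ₗ[ℝ] C4 := (LinearMap.lsmul ℂ C4 Complex.I).restrictScalars ℝ

/-- The quaternion `z + w j`. -/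
def toQuat (z w : ℂ) : ℍ[ℝ] := ⟨z.re, z.im, w.re, w.im⟩

@[simp] lemma toQuat_re (z w : ℂ) : (toQuat z w).re = z.re := rfl
@[simp] lemma toQuat_imI (z w : ℂ) : (toQuat z w).imI = z.im := rfl
@[simp] lemma toQuat_imJ (z w : ℂ) : (toQuat z w).imJ = w.re := rfl
@[simp] lemma toQuat_imK (z w : ℂ) : (toQuat z w).imK = w.im := rfl

/-- Left multiplication by `j` on `ℍ² = ℂ⁴`, where `(z₀, z₁, z₂, z₃)` is identified with
`(z₀ + z₁ j, z₂ + z₃ j)`. -/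
def jMul (p : C4) : C4 := !₂[-star (p 1), star (p 0), -star (p 3), star (p 2)]

/-- Left multiplication by `k = i j` on `ℍ² = ℂ⁴`. -/
def kMul (p : C4) : C4 := iMul (jMul p)

lemma toQuat_iMul (p : C4) :
    toQuat (iMul p 0) (iMul p 1) = toQuat Complex.I 0 * toQuat (p 0) (p 1) ∧
    toQuat (iMul p 2) (iMul p 3) = toQuat Complex.I 0 * toQuat (p 2) (p 3) := by
  constructor <;> (rw [Quaternion.ext_iff]; simp [iMul])

lemma toQuat_jMul (p : C4) :
    toQuat (jMul p 0) (jMul p 1) = toQuat 0 1 * toQuat (p 0) (p 1) ∧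
    toQuat (jMul p 2) (jMul p 3) = toQuat 0 1 * toQuat (p 2) (p 3) := by
  constructor <;> (rw [Quaternion.ext_iff]; simp [jMul])

/-- The lift of `𝒟₁²` to `S⁷`. -/
def liftD1 (p : C4) : Submodule ℝ C4 := Submodule.span ℝ {jMul p, kMul p}

/-- The lift of `𝒟₂⁴` to `S⁷`: the orthogonal complement in `T_p S⁷ = p^⊥` of `i p, j p, k p`. -/
def liftD2 (p : C4) : Submodule ℝ C4 := (Submodule.span ℝ {p, iMul p, jMul p, kMul p})ᗮ

/-- The distribution `𝒟₁²` on `ℂP³`, tangent to the fibres of the twistor fibration. -/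
def D1 (x : CP3) : Submodule ℝ (T x) := (liftD1 (unitRep x)).map (dHopf x)

/-- The distribution `𝒟₂⁴` on `ℂP³`. -/
def D2 (x : CP3) : Submodule ℝ (T x) := (liftD2 (unitRep x)).map (dHopf x)

/-- The almost complex structure `J₁` of the Kähler `ℂP³`, induced by multiplication by `i`. -/
def J1 (x : CP3) : T x →ₗ[ℝ] T x := dHopf x ∘ₗ iMul ∘ₗ hopfLift x

/-- The almost product structure `P`: minus the identity on `𝒟₁²` and the identity on `𝒟₂⁴`. -/
def P (x : CP3) : T x →ₗ[ℝ] T x :=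
  dHopf x ∘ₗ ((liftD1 (unitRep x))ᗮ.reflection : C4 →ₗ[ℝ] C4) ∘ₗ hopfLift x

/-- The almost complex structure `J = P J₁` of the nearly Kähler `ℂP³`. -/
def J (x : CP3) : T x →ₗ[ℝ] T x := P x ∘ₗ J1 x

/-- The Fubini-Study metric, for which the Hopf fibration is a Riemannian submersion. -/
def g1 (x : CP3) (X Y : T x) : ℝ := ⟪hopfLift x X, hopfLift x Y⟫_ℝ

/-- The nearly Kähler metric. -/
def g (x : CP3) (X Y : T x) : ℝ := 3 / 2 * g1 x X Y + 1 / 2 * g1 x X (P x Y)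

/-! The structures do not depend on the choice of `unitRep x`, and `P` is as described. -/

lemma inner_real_eq (v w : C4) : ⟪v, w⟫_ℝ = (⟪v, w⟫_ℂ).re := by
  simp [PiLp.inner_apply, Fin.sum_univ_four]

lemma hopfLift_dHopf (x : CP3) (v : C4) (hv : v ∈ hopfHorizontal (unitRep x)) :
    hopfLift x (dHopf x v) = v := by
  have : dHopf x v = hopfIso x ⟨v, hv⟩ := rfl
  rw [this]
  simp [hopfLift]

lemma proj_smul (c : ℂ) (hc : c ≠ 0) (p : C4) : proj (c • p) = proj p := by
  by_cases hp : p = 0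
  · simp [hp]
  · rw [proj_of_ne hp, proj_of_ne (smul_ne_zero hc hp), Projectivization.mk_eq_mk_iff']
    exact ⟨c, rfl⟩

lemma dproj_smul (c : ℂ) (hc : c ≠ 0) (p : C4) (hp : p ≠ 0) (v : C4) :
    dproj (c • p) (c • v) = dproj p v := by
  obtain ⟨i, -, h⟩ := exists_hasMFDerivAt_proj (c • p) (smul_ne_zero hc hp)
  let L : C4 →L[ℝ] C4 := (c • ContinuousLinearMap.id ℂ C4).restrictScalars ℝ
  have hL : HasMFDerivAt 𝓘(ℝ, C4) 𝓘(ℝ, C4) (fun w : C4 => c • w) p L :=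
    (L.hasFDerivAt (x := p)).hasMFDerivAt
  have h1 := HasMFDerivAt.comp p h hL
  have h2 : proj ∘ (fun w : C4 => c • w) = proj := funext fun w => proj_smul c hc w
  rw [h2] at h1
  have h3 := h1.mfderiv
  rw [dproj, dproj, h3, h.mfderiv]
  rfl

lemma exists_unitRep_proj (p : C4) (hp : ‖p‖ = 1) :
    ∃ c : ℂ, ‖c‖ = 1 ∧ unitRep (proj p) = c • p := by
  have hp0 : p ≠ 0 := by rintro rfl; simp at hp
  have h := proj_unitRep (proj p)
  rw [proj_of_ne (unitRep_ne_zero _), proj_of_ne hp0, Projectivization.mk_eq_mk_iff'] at h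
  obtain ⟨c, hc⟩ := h
  rw [← proj_of_ne hp0] at hc
  refine ⟨c, ?_, hc.symm⟩
  have := congrArg norm hc
  rwa [norm_smul, hp, norm_unitRep, mul_one] at this

lemma hopfHorizontal_smul (c : ℂ) (hc : c ≠ 0) (p : C4) :
    hopfHorizontal (c • p) = hopfHorizontal p := by
  rw [hopfHorizontal, hopfHorizontal, Submodule.span_singleton_smul_eq hc.isUnit]

lemma smul_mem_hopfHorizontal (c : ℂ) {p v : C4} (hv : v ∈ hopfHorizontal p) :
    c • v ∈ hopfHorizontal p :=
  ((ℂ ∙ p)ᗮ).smul_mem c hv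

lemma hopfLift_dproj (p : C4) (c : ℂ) (hc : c ≠ 0) (hp : p ≠ 0)
    (h : unitRep (proj p) = c • p) (v : C4) (hv : v ∈ hopfHorizontal p) :
    hopfLift (proj p) (dproj p v) = c • v := by
  have h1 : dHopf (proj p) (c • v) = dproj p v := by
    change dproj (unitRep (proj p)) (c • v) = dproj p v
    rw [h, dproj_smul c hc p hp]
  rw [← h1]
  apply hopfLift_dHopf
  rw [h, hopfHorizontal_smul c hc]
  exact smul_mem_hopfHorizontal c hv

lemma liftD1_eq (p : C4) : liftD1 p = (ℂ ∙ jMul p).restrictScalars ℝ := by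
  ext v
  rw [liftD1, Submodule.mem_span_pair, Submodule.restrictScalars_mem,
    Submodule.mem_span_singleton]
  constructor
  · rintro ⟨a, b, rfl⟩
    refine ⟨a + b * Complex.I, ?_⟩
    ext k
    simp [kMul, iMul]
    ring
  · rintro ⟨c, rfl⟩
    refine ⟨c.re, c.im, ?_⟩
    ext k
    simp only [kMul, iMul, PiLp.add_apply, PiLp.smul_apply, LinearMap.coe_restrictScalars,
      LinearMap.lsmul_apply, smul_eq_mul, Complex.real_smul]
    nth_rewrite 3 [← Complex.re_add_im c]
    ring

lemma jMul_smul (c : ℂ) (p : C4) : jMul (c • p) = star c • jMul p := by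
  ext k
  fin_cases k <;> simp [jMul]

lemma liftD1_smul (c : ℂ) (hc : c ≠ 0) (p : C4) : liftD1 (c • p) = liftD1 p := by
  rw [liftD1_eq, liftD1_eq, jMul_smul,
    Submodule.span_singleton_smul_eq (star_ne_zero.2 hc).isUnit]

lemma smul_mem_liftD1 (c : ℂ) {p v : C4} (hv : v ∈ liftD1 p) : c • v ∈ liftD1 p := by
  rw [liftD1_eq] at *
  exact (ℂ ∙ jMul p).smul_mem c hv

lemma smul_mem_liftD1_orthogonal (c : ℂ) {p v : C4} (hv : v ∈ (liftD1 p)ᗮ) :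
    c • v ∈ (liftD1 p)ᗮ := by
  intro u hu
  have h := hv (star c • u) (smul_mem_liftD1 _ hu)
  rw [inner_real_eq] at *
  rw [inner_smul_left] at h
  rw [inner_smul_right]
  simpa using h

lemma inner_jMul (p : C4) : ⟪p, jMul p⟫_ℂ = 0 := by
  simp [PiLp.inner_apply, Fin.sum_univ_four, jMul]
  ring

lemma liftD1_le (p : C4) : liftD1 p ≤ hopfHorizontal p := by
  rw [liftD1_eq]
  intro v hv
  obtain ⟨c, rfl⟩ := Submodule.mem_span_singleton.1 hv
  apply smul_mem_hopfHorizontal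
  exact Submodule.mem_orthogonal_singleton_iff_inner_right.2 (inner_jMul p)

lemma liftD2_le (p : C4) : liftD2 p ≤ hopfHorizontal p := by
  intro v hv
  refine Submodule.mem_orthogonal_singleton_iff_inner_right.2 ?_
  have h1 : ⟪p, v⟫_ℝ = 0 := hv p (Submodule.subset_span (by simp))
  have h2 : ⟪iMul p, v⟫_ℝ = 0 := hv (iMul p) (Submodule.subset_span (by simp))
  rw [inner_real_eq] at h1 h2
  have h3 : iMul p = Complex.I • p := rfl
  rw [h3, inner_smul_left] at h2
  apply Complex.ext
  · simpa using h1
  · simpa using h2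

lemma liftD2_le_orthogonal (p : C4) : liftD2 p ≤ (liftD1 p)ᗮ :=
  Submodule.orthogonal_le (Submodule.span_mono (by intro v; simp; tauto))

lemma P_of_mem_D1 (x : CP3) (X : T x) (hX : X ∈ D1 x) : P x X = -X := by
  obtain ⟨v, hv, rfl⟩ := hX
  have h1 := hopfLift_dHopf x v (liftD1_le _ hv)
  have h2 : (liftD1 (unitRep x))ᗮ.reflection v = -v :=
    Submodule.reflection_mem_subspace_orthogonal_precomplement_eq_neg hv
  simp [P, h1, h2]

lemma P_of_mem_D2 (x : CP3) (X : T x) (hX : X ∈ D2 x) : P x X = X := by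
  obtain ⟨v, hv, rfl⟩ := hX
  have h1 := hopfLift_dHopf x v (liftD2_le _ hv)
  have h2 : (liftD1 (unitRep x))ᗮ.reflection v = v :=
    Submodule.reflection_mem_subspace_eq_self (liftD2_le_orthogonal _ hv)
  simp [P, h1, h2]

lemma D1_sup_D2 (x : CP3) : D1 x ⊔ D2 x = ⊤ := by
  rw [eq_top_iff]
  intro X _
  obtain ⟨⟨u, hu⟩, rfl⟩ := (hopfIso x).surjective X
  change dHopf x u ∈ _
  obtain ⟨a, ha, b, hb, rfl⟩ := (liftD1 (unitRep x)).exists_add_mem_mem_orthogonal u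
  have hb' : b ∈ hopfHorizontal (unitRep x) := by
    simpa using Submodule.sub_mem _ hu (liftD1_le _ ha)
  rw [map_add]
  refine Submodule.add_mem_sup (Submodule.mem_map_of_mem ha) (Submodule.mem_map_of_mem ?_)
  have h0 : ⟪unitRep x, b⟫_ℂ = 0 := Submodule.mem_orthogonal_singleton_iff_inner_right.1 hb'
  rw [liftD2, Submodule.mem_orthogonal]
  intro w hw
  induction hw using Submodule.span_induction with
  | mem w hw =>
    have h3 : iMul (unitRep x) = Complex.I • unitRep x := rfl
    rcases hw with rfl | rfl | rfl | rfl
    · rw [inner_real_eq, h0]; simp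
    · rw [inner_real_eq, h3, inner_smul_left, h0]; simp
    · exact hb _ (Submodule.subset_span (by simp))
    · exact hb _ (Submodule.subset_span (by simp))
  | zero => simp
  | add _ _ _ _ h1 h2 => rw [inner_add_left, h1, h2, add_zero]
  | smul c _ _ h1 => rw [inner_smul_left, h1, mul_zero]

lemma J1_dproj (p : C4) (hp : ‖p‖ = 1) (v : C4) (hv : v ∈ hopfHorizontal p) :
    J1 (proj p) (dproj p v) = dproj p (iMul v) := by
  have hp0 : p ≠ 0 := by rintro rfl; simp at hp
  obtain ⟨c, hc, h⟩ := exists_unitRep_proj p hp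
  have hc0 : c ≠ 0 := by rintro rfl; simp at hc
  have h1 := hopfLift_dproj p c hc0 hp0 h v hv
  change dproj (unitRep (proj p)) (iMul (hopfLift (proj p) (dproj p v))) = dproj p (iMul v)
  have h2 : iMul (c • v) = c • iMul v := smul_comm Complex.I c v
  rw [h1, h2, h, dproj_smul c hc0 p hp0]

lemma P_dproj (p : C4) (hp : ‖p‖ = 1) (v : C4) (hv : v ∈ hopfHorizontal p) :
    P (proj p) (dproj p v) = dproj p ((liftD1 p)ᗮ.reflection v) := by
  have hp0 : p ≠ 0 := by rintro rfl; simp at hp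
  obtain ⟨c, hc, h⟩ := exists_unitRep_proj p hp
  have hc0 : c ≠ 0 := by rintro rfl; simp at hc
  have h1 := hopfLift_dproj p c hc0 hp0 h v hv
  change dproj (unitRep (proj p)) ((liftD1 (unitRep (proj p)))ᗮ.reflection
    (hopfLift (proj p) (dproj p v))) = dproj p ((liftD1 p)ᗮ.reflection v)
  have h2 : (liftD1 p)ᗮ.reflection (c • v) = c • (liftD1 p)ᗮ.reflection v := by
    obtain ⟨a, ha, b, hb, rfl⟩ := (liftD1 p).exists_add_mem_mem_orthogonal v
    have ha' : c • a ∈ liftD1 p := smul_mem_liftD1 c ha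
    have hb' : c • b ∈ (liftD1 p)ᗮ := smul_mem_liftD1_orthogonal c hb
    rw [smul_add, map_add, map_add,
      Submodule.reflection_mem_subspace_orthogonal_precomplement_eq_neg ha,
      Submodule.reflection_mem_subspace_orthogonal_precomplement_eq_neg ha',
      Submodule.reflection_mem_subspace_eq_self hb, Submodule.reflection_mem_subspace_eq_self hb',
      smul_add, smul_neg]
  have h3 : liftD1 (unitRep (proj p)) = liftD1 p := by rw [h, liftD1_smul c hc0]
  have h4 : ∀ K : Submodule ℝ C4, K = liftD1 p →
      Kᗮ.reflection (c • v) = c • (liftD1 p)ᗮ.reflection v := by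
    rintro _ rfl
    exact h2
  rw [h1, h4 _ h3, h, dproj_smul c hc0 p hp0]

lemma g1_dproj (p : C4) (hp : ‖p‖ = 1) (v w : C4) (hv : v ∈ hopfHorizontal p)
    (hw : w ∈ hopfHorizontal p) : g1 (proj p) (dproj p v) (dproj p w) = ⟪v, w⟫_ℝ := by
  have hp0 : p ≠ 0 := by rintro rfl; simp at hp
  obtain ⟨c, hc, h⟩ := exists_unitRep_proj p hp
  have hc0 : c ≠ 0 := by rintro rfl; simp at hc
  change ⟪hopfLift (proj p) (dproj p v), hopfLift (proj p) (dproj p w)⟫_ℝ = _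
  rw [hopfLift_dproj p c hc0 hp0 h v hv, hopfLift_dproj p c hc0 hp0 h w hw,
    inner_real_eq, inner_real_eq, inner_smul_left, inner_smul_right,
    ← mul_assoc, ← Complex.normSq_eq_conj_mul_self, Complex.normSq_eq_norm_sq, hc]
  simp

/-! ### The twistor fibration -/

/-- The unit sphere `S⁴` in `ℝ⁵`. -/
abbrev S4 : Type := Metric.sphere (0 : EuclideanSpace ℝ (Fin 5)) 1

/-- The map `(p, q) ↦ (|p|² - |q|², 2 p̄ q) / (|p|² + |q|²)` from `ℍ² ∖ {0}` to `S⁴ ⊂ ℝ ⊕ ℍ`; it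
induces the usual identification of `ℍP¹` (lines for left multiplication) with `S⁴`. -/
def tauVec (v : C4) : EuclideanSpace ℝ (Fin 5) :=
  let p := toQuat (v 0) (v 1)
  let q := toQuat (v 2) (v 3)
  let m := star p * q
  (Quaternion.normSq p + Quaternion.normSq q)⁻¹ •
    !₂[Quaternion.normSq p - Quaternion.normSq q, 2 * m.re, 2 * m.imI, 2 * m.imJ, 2 * m.imK]

lemma normSq_add_ne_zero (v : C4) (hv : v ≠ 0) :
    Quaternion.normSq (toQuat (v 0) (v 1)) + Quaternion.normSq (toQuat (v 2) (v 3)) ≠ 0 := by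
  intro h
  have h1 := (add_eq_zero_iff_of_nonneg Quaternion.normSq_nonneg Quaternion.normSq_nonneg).1 h
  rw [Quaternion.normSq_eq_zero, Quaternion.normSq_eq_zero, Quaternion.ext_iff,
    Quaternion.ext_iff] at h1
  simp only [toQuat_re, toQuat_imI, toQuat_imJ, toQuat_imK, Quaternion.re_zero, Quaternion.imI_zero, Quaternion.imJ_zero,
    Quaternion.imK_zero] at h1
  apply hv
  ext k
  fin_cases k <;> apply Complex.ext <;> simp [h1]

lemma tauVec_mem (v : C4) (hv : v ≠ 0) :
    tauVec v ∈ Metric.sphere (0 : EuclideanSpace ℝ (Fin 5)) 1 := by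
  have h := normSq_add_ne_zero v hv
  rw [mem_sphere_zero_iff_norm, ← sq_eq_sq₀ (norm_nonneg _) zero_le_one, EuclideanSpace.norm_sq_eq]
  simp only [tauVec, Fin.sum_univ_five, PiLp.smul_apply, smul_eq_mul, Real.norm_eq_abs, sq_abs]
  rw [Quaternion.normSq_def', Quaternion.normSq_def'] at *
  simp at h ⊢
  field_simp
  ring

lemma tauVec_smul (c : ℂ) (hc : c ≠ 0) (v : C4) : tauVec (c • v) = tauVec v := by
  have hn : ∀ z w : ℂ, Quaternion.normSq (toQuat (c * z) (c * w)) =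
      Complex.normSq c * Quaternion.normSq (toQuat z w) := by
    intro z w
    simp only [Quaternion.normSq_def', toQuat_re, toQuat_imI, toQuat_imJ, toQuat_imK, Complex.normSq_apply, Complex.mul_re,
      Complex.mul_im]
    ring
  have hm : ∀ z w z' w' : ℂ, star (toQuat (c * z) (c * w)) * toQuat (c * z') (c * w') =
      Complex.normSq c • (star (toQuat z w) * toQuat z' w') := by
    intro z w z' w'
    rw [Quaternion.ext_iff]
    simp only [toQuat_re, toQuat_imI, toQuat_imJ, toQuat_imK, Complex.normSq_apply, Complex.mul_re, Complex.mul_im, Quaternion.re_mul,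
      Quaternion.imI_mul, Quaternion.imJ_mul, Quaternion.imK_mul, Quaternion.re_star,
      Quaternion.imI_star, Quaternion.imJ_star, Quaternion.imK_star, Quaternion.re_smul,
      Quaternion.imI_smul, Quaternion.imJ_smul, Quaternion.imK_smul, smul_eq_mul]
    refine ⟨?_, ?_, ?_, ?_⟩ <;> ring
  have hc' : Complex.normSq c ≠ 0 := by simpa using hc
  ext k
  simp only [tauVec, PiLp.smul_apply, smul_eq_mul, hn, hm, ← mul_add, ← mul_sub, mul_inv]
  fin_cases k <;> simp <;> field_simp

/-- The twistor fibration `τ : ℂP³ → S⁴`. -/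
def tau (x : CP3) : S4 :=
  Projectivization.lift (fun v : {v : C4 // v ≠ 0} => (⟨tauVec v.1, tauVec_mem v.1 v.2⟩ : S4))
    (by
      rintro ⟨a, ha⟩ ⟨b, hb⟩ t rfl
      have ht : t ≠ 0 := by rintro rfl; simp at ha
      exact Subtype.ext (tauVec_smul t ht b)) x

/-! ### Hypersurfaces -/

/-- An immersed smooth hypersurface of `ℂP³`: a smooth map from a five-dimensional manifold whose
differential is injective everywhere. -/
structure IsHypersurface {H : Type*} [TopologicalSpace H]
    [ChartedSpace (EuclideanSpace ℝ (Fin 5)) H] (f : H → CP3) : Prop where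
  contMDiff : ContMDiff (𝓡 5) 𝓘(ℝ, C3) ∞ f
  injective_mfderiv : ∀ x, Injective (mfderiv (𝓡 5) 𝓘(ℝ, C3) f x)

/-- The tangent space of the hypersurface at `x`, as a subspace of the tangent space of `ℂP³`. -/
def tangent {H : Type*} [TopologicalSpace H] [ChartedSpace (EuclideanSpace ℝ (Fin 5)) H]
    (f : H → CP3) (x : H) : Submodule ℝ (T (f x)) :=
  LinearMap.range (mfderiv (𝓡 5) 𝓘(ℝ, C3) f x : TangentSpace (𝓡 5) x →ₗ[ℝ] T (f x))

/-- `N` is a unit normal of the hypersurface at `x`, for the nearly Kähler metric. -/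
def IsUnitNormal {H : Type*} [TopologicalSpace H] [ChartedSpace (EuclideanSpace ℝ (Fin 5)) H]
    (f : H → CP3) (x : H) (N : T (f x)) : Prop :=
  g (f x) N N = 1 ∧ ∀ X ∈ tangent f x, g (f x) X N = 0

/-- The angle `θ ∈ [0, π/2]` with `cos (2 θ) = g(N, P N)`. -/
def angle (x : CP3) (N : T x) : ℝ := Real.arccos (g x N (P x N)) / 2

/-- The hypersurface is horizontal: its angle function is identically zero. (The angle is the same
for the two unit normals at a point.) -/
def IsHorizontal {H : Type*} [TopologicalSpace H] [ChartedSpace (EuclideanSpace ℝ (Fin 5)) H]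
    (f : H → CP3) : Prop :=
  ∀ (x : H) (N : T (f x)), IsUnitNormal f x N → angle (f x) N = 0

/-- The distribution `span {N, J N, J₁ N, P N}` is two-dimensional. -/
def HasTwoDimSpan {H : Type*} [TopologicalSpace H] [ChartedSpace (EuclideanSpace ℝ (Fin 5)) H]
    (f : H → CP3) : Prop :=
  ∀ (x : H) (N : T (f x)), IsUnitNormal f x N →
    finrank ℝ (Submodule.span ℝ {N, J (f x) N, J1 (f x) N, P (f x) N}) = 2

/-- The distribution `span {J N}^⊥ ∩ T H` is preserved by `P`. -/
def IsPInvariant {H : Type*} [TopologicalSpace H] [ChartedSpace (EuclideanSpace ℝ (Fin 5)) H]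
    (f : H → CP3) : Prop :=
  ∀ (x : H) (N : T (f x)), IsUnitNormal f x N →
    ∀ X ∈ tangent f x, g (f x) X (J (f x) N) = 0 →
      P (f x) X ∈ tangent f x ∧ g (f x) (P (f x) X) (J (f x) N) = 0

/-- The distribution `span {J N} ∩ T H` is preserved by `P`. -/
def IsPInvariantLine {H : Type*} [TopologicalSpace H] [ChartedSpace (EuclideanSpace ℝ (Fin 5)) H]
    (f : H → CP3) : Prop :=
  ∀ (x : H) (N : T (f x)), IsUnitNormal f x N →
    ∀ X ∈ Submodule.span ℝ {J (f x) N} ⊓ tangent f x,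
      P (f x) X ∈ Submodule.span ℝ {J (f x) N} ⊓ tangent f x

/-- `M ⊆ S⁴` is an (embedded, smooth) hypersurface: near each of its points it is a regular level
set of a smooth function. -/
def IsHypersurfaceS4 (M : Set S4) : Prop :=
  ∀ y ∈ M, ∃ U : Set S4, IsOpen U ∧ y ∈ U ∧ ∃ φ : S4 → ℝ, ContMDiffOn (𝓡 4) 𝓘(ℝ, ℝ) ∞ φ U ∧
    (∀ z ∈ U, mfderiv (𝓡 4) 𝓘(ℝ, ℝ) φ z ≠ 0) ∧ M ∩ U = {z ∈ U | φ z = 0}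

/-- The hypersurface is locally the pre-image under the twistor fibration of a hypersurface of
`S⁴`: each point of `H` has an open neighbourhood whose image is an open subset of such a
pre-image. -/
def IsLocallyPreimage {H : Type*} [TopologicalSpace H] (f : H → CP3) : Prop :=
  ∀ x : H, ∃ U : Set H, IsOpen U ∧ x ∈ U ∧ ∃ V : Set CP3, IsOpen V ∧
    ∃ M : Set S4, IsHypersurfaceS4 M ∧ f '' U = V ∩ tau ⁻¹' M

/-- The image of the hypersurface is the full pre-image under the twistor fibration of a
hypersurface of `S⁴`. -/
def IsPreimage {H : Type*} (f : H → CP3) : Prop :=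
  ∃ M : Set S4, IsHypersurfaceS4 M ∧ range f = tau ⁻¹' M

end NKCP3

end

/-! Pointwise, everything is linear algebra of `P`, a `g`-self-adjoint involution whose eigenspaces
are `D1` (eigenvalue -1) and `D2` (eigenvalue 1). Equality in Cauchy–Schwarz turns θ = 0 into PN =
N; by self-adjointness this says that N is orthogonal to `D1`, so that `D1` is tangent to the
hypersurface (`D1_le_tangent_iff`). As `P` commutes with `J1` and `J`, each of the conditions 2, 3,
4 is equivalent at every single point to PN = N or PN = -N, i.e. to the tangent space containing
`D1` or `D2` (`ContainsDistribution`).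

The sign -1 cannot be excluded at one point, only on an open set. Since `D1` is the kernel of dτ, it
fails to be tangent exactly where τ ∘ f is a submersion; these points form an open set, and there
`D2` would be tangent. But `D2` is the kernel of the holomorphic contact form `contact`. On a
hypersurface tangent to `D2` the pulled-back form has real rank one, so at each point its values lie
on a real line of ℂ. Differentiating this property, its exterior derivative restricted to the kernel
takes values on the same line. That derivative is, up to a factor 2, the complex symplectic form,
whose values on (y, jy) and (iy, jy) are |y|² and a complex number orthogonal to it: a contradiction
(`not_D2_le_tangent_of_isOpen`).

For the preimages, a hypersurface tangent to the fibres of a submersion is, after straightening the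
submersion, a product of a hypersurface of the base with the fibre direction
(`exists_image_eq_preimage_levelSet`). Conversely, if φ ∘ τ is a local defining function, its
differential kills ker dτ = `D1`. Globally, the image meets each fibre of τ in a relatively open
set; if that set is also closed, connectedness of the fibres makes it empty or the whole fibre
(`isPreimage_of_isLocallyPreimage`). -/

namespace NKCP3

/-! ### Local normal forms in normed spaces -/

section NormalForm

variable {E F : Type*} [NormedAddCommGroup E] [NormedSpace ℝ E] [FiniteDimensional ℝ E]
  [NormedAddCommGroup F] [NormedSpace ℝ F] [FiniteDimensional ℝ F]

/-- The inverse function theorem, with smoothness of the inverse on a neighbourhood. -/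
lemma exists_openPartialHomeomorph_of_bijective_fderiv {f : E → F} {Ω : Set E} {a : E}
    (hΩ : IsOpen Ω) (ha : a ∈ Ω) (hf : ContDiffOn ℝ ∞ f Ω) (hbij : Bijective (fderiv ℝ f a)) :
    ∃ Φ : OpenPartialHomeomorph E F, a ∈ Φ.source ∧ Φ.source ⊆ Ω ∧ (Φ : E → F) = f ∧
      ContDiffOn ℝ ∞ Φ.symm Φ.target ∧ ∀ x ∈ Φ.source, Bijective (fderiv ℝ f x) := by
  have : CompleteSpace E := FiniteDimensional.complete ℝ E
  have : CompleteSpace F := FiniteDimensional.complete ℝ F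
  have hfa : ∀ x ∈ Ω, ContDiffAt ℝ ∞ f x := fun x hx => hf.contDiffAt (hΩ.mem_nhds hx)
  have hd : ∀ x ∈ Ω, HasFDerivAt f (fderiv ℝ f x) x := fun x hx =>
    ((hfa x hx).differentiableAt (by simp)).hasFDerivAt
  let e : E ≃L[ℝ] F := (LinearEquiv.ofBijective (fderiv ℝ f a : E →ₗ[ℝ] F)
    hbij).toContinuousLinearEquiv
  have he : (e : E →L[ℝ] F) = fderiv ℝ f a := by ext v; rfl
  have hde : HasFDerivAt f (e : E →L[ℝ] F) a := by rw [he]; exact hd a ha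
  let Φ₀ := (hfa a ha).toOpenPartialHomeomorph f hde (by simp)
  have hcont : ContinuousOn (fderiv ℝ f) Ω := hf.continuousOn_fderiv_of_isOpen hΩ (by simp)
  -- Invertible operators form an open set and the derivative is continuous, so the derivative stays
  -- invertible near `a`. Shrinking the source to such points makes the inverse smooth on the whole
  -- target, not just at the image of `a`.
  let O : Set E := Ω ∩ fderiv ℝ f ⁻¹' range ((↑) : (E ≃L[ℝ] F) → E →L[ℝ] F)
  have hO : IsOpen O := hcont.isOpen_inter_preimage hΩ ContinuousLinearEquiv.isOpen
  have haO : a ∈ O := ⟨ha, e, he⟩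
  refine ⟨Φ₀.restrOpen O hO, ⟨?_, haO⟩, fun x hx => hx.2.1, rfl, ?_, ?_⟩
  · exact (hfa a ha).mem_toOpenPartialHomeomorph_source hde (by simp)
  · intro y hy
    have hx : (Φ₀.restrOpen O hO).symm y ∈ (Φ₀.restrOpen O hO).source :=
      (Φ₀.restrOpen O hO).map_target hy
    obtain ⟨e', he'⟩ := hx.2.2
    refine (OpenPartialHomeomorph.contDiffAt_symm (f₀' := e') _ hy ?_ ?_).contDiffWithinAt
    · rw [he']
      exact hd _ hx.2.1
    · exact hfa _ hx.2.1
  · intro x hx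
    obtain ⟨e', he'⟩ := hx.2.2
    rw [← he']
    exact e'.bijective

variable {A S K : Type*} [NormedAddCommGroup A] [NormedSpace ℝ A] [FiniteDimensional ℝ A]
  [NormedAddCommGroup S] [NormedSpace ℝ S] [FiniteDimensional ℝ S]
  [NormedAddCommGroup K] [NormedSpace ℝ K] [FiniteDimensional ℝ K]

/-- An immersed hypersurface of `(S × ℝ) × K`, transversal to the factor `ℝ` and tangent to the
factor `K`, is locally the product with `K` of the graph of a function `S → ℝ`. -/
lemma exists_image_eq_graph_prod {f : A → (S × ℝ) × K} {Ω : Set A} {a : A} (hΩ : IsOpen Ω)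
    (ha : a ∈ Ω) (hf : ContDiffOn ℝ ∞ f Ω)
    (hbij : Bijective (fderiv ℝ (fun u => ((f u).1.1, (f u).2)) a))
    (hK : ∀ u ∈ Ω, ∀ k : K, ∃ v, fderiv ℝ f u v = ((0, 0), k)) :
    ∃ U ⊆ Ω, IsOpen U ∧ a ∈ U ∧ ∃ (B₁ : Set S) (B₂ : Set K) (h : S → ℝ), IsOpen B₁ ∧ IsOpen B₂ ∧
      ContDiffOn ℝ ∞ h B₁ ∧ f '' U = {z | z.1.1 ∈ B₁ ∧ z.2 ∈ B₂ ∧ z.1.2 = h z.1.1} := by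
  have hG : ContDiffOn ℝ ∞ (fun u => ((f u).1.1, (f u).2)) Ω :=
    (hf.fst.fst).prodMk hf.snd
  obtain ⟨Ψ, haΨ, hΨΩ, hΨ, hsymm, -⟩ :=
    exists_openPartialHomeomorph_of_bijective_fderiv hΩ ha hG hbij
  have hΨa : ∀ u, Ψ u = ((f u).1.1, (f u).2) := fun u => by rw [hΨ]
  set s₀ := (f a).1.1
  set k₀ := (f a).2
  have hmem : Ψ.target ∈ 𝓝 (s₀, k₀) := by
    rw [← hΨa a]
    exact Ψ.open_target.mem_nhds (Ψ.map_source haΨ)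
  obtain ⟨ε, hε, hball⟩ := Metric.mem_nhds_iff.1 hmem
  rw [← ball_prod_same] at hball
  set B₁ := Metric.ball s₀ ε
  set B₂ := Metric.ball k₀ ε
  -- The height of the hypersurface over `S × K`. The rest of the proof shows that it does not
  -- depend on the `K`-coordinate.
  let H : S × K → ℝ := fun z => (f (Ψ.symm z)).1.2
  have hH : ContDiffOn ℝ ∞ (fun z => f (Ψ.symm z)) Ψ.target :=
    hf.comp hsymm (fun z hz => hΨΩ (Ψ.map_target hz))
  have hval : ∀ z ∈ Ψ.target, f (Ψ.symm z) = ((z.1, H z), z.2) := by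
    intro z hz
    have h := Ψ.right_inv hz
    rw [hΨa] at h
    have h1 : (f (Ψ.symm z)).1.1 = z.1 := congrArg Prod.fst h
    have h2 : (f (Ψ.symm z)).2 = z.2 := congrArg Prod.snd h
    exact Prod.ext (Prod.ext h1 rfl) h2
  have hHs : ContDiffOn ℝ ∞ H Ψ.target := hH.fst.snd
  -- The tangent vector ((0, 0), k) is the image of some `v`, which the chart `Ψ` sends to (0, k).
  -- Moving the chart coordinates along (0, k) thus moves the hypersurface along ((0, 0), k), with
  -- no change of height.
  have hHd : ∀ z ∈ Ψ.target, ∀ k, fderiv ℝ H z (0, k) = 0 := by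
    intro z hz k
    have hu := hΨΩ (Ψ.map_target hz)
    obtain ⟨v, hv⟩ := hK _ hu k
    have hfd : HasFDerivAt f (fderiv ℝ f (Ψ.symm z)) (Ψ.symm z) :=
      ((hf.contDiffAt (hΩ.mem_nhds hu)).differentiableAt (by simp)).hasFDerivAt
    have hsd : HasFDerivAt Ψ.symm (fderiv ℝ Ψ.symm z) z :=
      ((hsymm.contDiffAt (Ψ.open_target.mem_nhds hz)).differentiableAt (by simp)).hasFDerivAt
    have hGd := hfd.fst.fst.prodMk hfd.snd
    rw [← hΨ] at hGd
    have h1 : HasFDerivAt (Ψ.symm ∘ Ψ) _ (Ψ.symm z) :=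
      HasFDerivAt.comp (Ψ.symm z) (g := Ψ.symm) (by rw [Ψ.right_inv hz]; exact hsd) hGd
    have h2 : HasFDerivAt (Ψ.symm ∘ Ψ) (ContinuousLinearMap.id ℝ A) (Ψ.symm z) :=
      (hasFDerivAt_id _).congr_of_eventuallyEq (Ψ.eventually_left_inverse (Ψ.map_target hz))
    have h3 := congrArg (fun T : A →L[ℝ] A => T v) (h1.unique h2)
    have h4 : fderiv ℝ Ψ.symm z (0, k) = v := by
      simpa [hv] using h3
    have h5 := (hfd.comp z hsd).fst.snd
    have h6 : fderiv ℝ H z = _ := h5.fderiv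
    rw [h6]
    simp [h4, hv]
  have hconst : ∀ s ∈ B₁, ∀ k ∈ B₂, H (s, k) = H (s, k₀) := by
    intro s hs k hk
    have hmaps : ∀ k ∈ B₂, (s, k) ∈ Ψ.target := fun k hk => hball ⟨hs, hk⟩
    have hd : ∀ k ∈ B₂, HasFDerivAt (fun k => H (s, k)) (0 : K →L[ℝ] ℝ) k := by
      intro k hk
      have h1 : HasFDerivAt H (fderiv ℝ H (s, k)) (s, k) :=
        ((hHs.contDiffAt (Ψ.open_target.mem_nhds (hmaps k hk))).differentiableAt
          (by simp)).hasFDerivAt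
      have h2 := h1.comp k (hasFDerivAt_prodMk_right s k)
      have h3 : (fderiv ℝ H (s, k)).comp (ContinuousLinearMap.inr ℝ S K) = 0 := by
        ext k'
        exact hHd _ (hmaps k hk) k'
      rw [h3] at h2
      exact h2
    refine Metric.isOpen_ball.is_const_of_fderiv_eq_zero (𝕜 := ℝ)
      (convex_ball k₀ ε).isPreconnected (f := fun k => H (s, k))
      (fun k hk => (hd k hk).differentiableAt.differentiableWithinAt)
      (fun k hk => (hd k hk).fderiv) hk (Metric.mem_ball_self hε)
  have hh : ContDiffOn ℝ ∞ (fun s => H (s, k₀)) B₁ :=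
    hHs.comp (contDiff_id.prodMk contDiff_const).contDiffOn
      (fun s hs => hball ⟨hs, Metric.mem_ball_self hε⟩)
  refine ⟨Ψ.source ∩ Ψ ⁻¹' (B₁ ×ˢ B₂), fun u hu => hΨΩ hu.1,
    Ψ.isOpen_inter_preimage (Metric.isOpen_ball.prod Metric.isOpen_ball), ⟨haΨ, ?_⟩, B₁, B₂,
    fun s => H (s, k₀), Metric.isOpen_ball, Metric.isOpen_ball, hh, ?_⟩
  · rw [mem_preimage, hΨa]
    exact ⟨Metric.mem_ball_self hε, Metric.mem_ball_self hε⟩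
  · ext z
    constructor
    · rintro ⟨u, ⟨hu, hu'⟩, rfl⟩
      have h1 := hval _ (Ψ.map_source hu)
      rw [Ψ.left_inv hu] at h1
      have h2 : (f u).1.2 = H (Ψ u) := by rw [h1]
      rw [mem_preimage, hΨa] at hu'
      refine ⟨hu'.1, hu'.2, ?_⟩
      rw [h2, hΨa]
      exact hconst _ hu'.1 _ hu'.2
    · rintro ⟨h1, h2, h3⟩
      have hz : (z.1.1, z.2) ∈ Ψ.target := hball ⟨h1, h2⟩
      refine ⟨Ψ.symm (z.1.1, z.2), ⟨Ψ.map_target hz, ?_⟩, ?_⟩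
      · rw [mem_preimage, Ψ.right_inv hz]
        exact ⟨h1, h2⟩
      · rw [hval _ hz]
        refine Prod.ext (Prod.ext rfl ?_) rfl
        change H (z.1.1, z.2) = _
        rw [hconst _ h1 _ h2, h3]

variable {C : Type*} [NormedAddCommGroup C] [NormedSpace ℝ C] [FiniteDimensional ℝ C]

/-- An immersed hypersurface that is tangent to the fibres of a submersion is locally the preimage
of a regular level set. -/
lemma exists_image_eq_preimage_levelSet {f : A → E} {τ : E → C} {Ω : Set A} {Ω' : Set E} {a : A}
    (hΩ : IsOpen Ω) (hΩ' : IsOpen Ω') (ha : a ∈ Ω) (hmaps : MapsTo f Ω Ω')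
    (hf : ContDiffOn ℝ ∞ f Ω) (hτ : ContDiffOn ℝ ∞ τ Ω')
    (hdim : finrank ℝ A + 1 = finrank ℝ E) (hinj : Injective (fderiv ℝ f a))
    (hsurj : Surjective (fderiv ℝ τ (f a)))
    (hker : ∀ u ∈ Ω, ∀ w, fderiv ℝ τ (f u) w = 0 → ∃ v, fderiv ℝ f u v = w) :
    ∃ U ⊆ Ω, IsOpen U ∧ a ∈ U ∧ ∃ V ⊆ Ω', IsOpen V ∧ ∃ (W : Set C) (φ : C → ℝ), IsOpen W ∧
      ContDiffOn ℝ ∞ φ W ∧ (∀ z ∈ W, fderiv ℝ φ z ≠ 0) ∧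
      f '' U = V ∩ τ ⁻¹' {z ∈ W | φ z = 0} := by
  have hfd : ∀ u ∈ Ω, HasFDerivAt f (fderiv ℝ f u) u := fun u hu =>
    ((hf.contDiffAt (hΩ.mem_nhds hu)).differentiableAt (by simp)).hasFDerivAt
  have hτd : ∀ u ∈ Ω', HasFDerivAt τ (fderiv ℝ τ u) u := fun u hu =>
    ((hτ.contDiffAt (hΩ'.mem_nhds hu)).differentiableAt (by simp)).hasFDerivAt
  have haΩ' : f a ∈ Ω' := hmaps ha
  set dτ : E →ₗ[ℝ] C := (fderiv ℝ τ (f a) : E →ₗ[ℝ] C)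
  set df : A →ₗ[ℝ] E := (fderiv ℝ f a : A →ₗ[ℝ] E)
  let K := LinearMap.ker dτ
  let R := LinearMap.range df
  have hKR : K ≤ R := fun w hw => hker a ha w hw
  -- The tangent space of the future level set. Because `R` is a hyperplane containing ker dτ, its
  -- image is a hyperplane of `C`; the complement `S'` is therefore a line and serves as the factor
  -- ℝ.
  let S := R.map dτ
  have hR : finrank ℝ R = finrank ℝ A := LinearMap.finrank_range_of_inj hinj
  have hKC : finrank ℝ C + finrank ℝ K = finrank ℝ E := by
    have := dτ.finrank_range_add_finrank_ker
    rwa [LinearMap.range_eq_top.2 hsurj, finrank_top] at this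
  have hSK : finrank ℝ S + finrank ℝ K = finrank ℝ A := by
    have h1 := (dτ.domRestrict R).finrank_range_add_finrank_ker
    have h2 : LinearMap.range (dτ.domRestrict R) = S := by
      rw [LinearMap.range_domRestrict]
    have h3 : finrank ℝ (LinearMap.ker (dτ.domRestrict R)) = finrank ℝ K := by
      rw [LinearMap.ker_domRestrict]
      exact (Submodule.comapSubtypeEquivOfLe hKR).finrank_eq
    rw [h2, h3, hR] at h1
    exact h1
  have hSC : finrank ℝ S + 1 = finrank ℝ C := by omega
  obtain ⟨S', hS'⟩ := S.exists_isCompl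
  have hS'1 : finrank ℝ S' = finrank ℝ ℝ := by
    have := Submodule.finrank_add_eq_of_isCompl hS'
    rw [finrank_self]
    omega
  let L : C ≃L[ℝ] S × ℝ := ((S.prodEquivOfIsCompl S' hS').symm ≪≫ₗ
    ((LinearEquiv.refl ℝ S).prodCongr (LinearEquiv.ofFinrankEq S' ℝ hS'1))).toContinuousLinearEquiv
  have hL : ∀ z ∈ S, (L z).1 = 0 → z = 0 := by
    intro z hz h
    have h1 : (L z).1 = ((S.prodEquivOfIsCompl S' hS').symm z).1 := rfl
    rw [h1, Submodule.prodEquivOfIsCompl_symm_apply_left S S' hS' ⟨z, hz⟩] at h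
    simpa using h
  obtain ⟨K', hK'⟩ := K.exists_isCompl
  let π : E →L[ℝ] K := LinearMap.toContinuousLinearMap (K.projectionOnto K' hK')
  have hπ : ∀ w ∈ K, π w = 0 → w = 0 := by
    intro w hw h
    have h1 : π w = ⟨w, hw⟩ := Submodule.projectionOnto_apply_left hK' ⟨w, hw⟩
    rw [h1] at h
    simpa using h
  -- Straightening of `τ`: the first component is `τ` in linear coordinates of the base, the second
  -- is a linear coordinate along the fibre. On the image of `f` it has the form required by the
  -- graph lemma.
  let T : E → (S × ℝ) × K := fun w => (L (τ w), π w)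
  have hTd : ∀ w ∈ Ω', HasFDerivAt T
      (((L : C →L[ℝ] S × ℝ).comp (fderiv ℝ τ w)).prod π) w := fun w hw =>
    ((L : C →L[ℝ] S × ℝ).hasFDerivAt.comp w (hτd w hw)).prodMk π.hasFDerivAt
  have hTs : ContDiffOn ℝ ∞ T Ω' :=
    ((L : C →L[ℝ] S × ℝ).contDiff.comp_contDiffOn hτ).prodMk π.contDiff.contDiffOn
  have hTinj : Injective (fderiv ℝ T (f a)) := by
    rw [(hTd _ haΩ').fderiv, injective_iff_map_eq_zero]
    intro w hw
    have h1 : L (dτ w) = 0 := congrArg Prod.fst hw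
    have h2 : π w = 0 := congrArg Prod.snd hw
    exact hπ w (LinearMap.mem_ker.2 (by simpa using h1)) h2
  have hTbij : Bijective (fderiv ℝ T (f a)) := by
    refine ⟨hTinj, ?_⟩
    have hfin : finrank ℝ E = finrank ℝ ((S × ℝ) × K) := by
      rw [finrank_prod, finrank_prod, finrank_self]
      omega
    exact (LinearMap.injective_iff_surjective_of_finrank_eq_finrank
      (f := (fderiv ℝ T (f a) : E →ₗ[ℝ] (S × ℝ) × K)) hfin).1 hTinj
  obtain ⟨Φ, haΦ, hΦΩ, hΦ, -, hΦbij⟩ :=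
    exists_openPartialHomeomorph_of_bijective_fderiv hΩ' haΩ' hTs hTbij
  let Ω₁ := Ω ∩ f ⁻¹' Φ.source
  have hΩ₁ : IsOpen Ω₁ := hf.continuousOn.isOpen_inter_preimage hΩ Φ.open_source
  have hcd : ∀ u ∈ Ω₁, HasFDerivAt (T ∘ f) ((fderiv ℝ T (f u)).comp (fderiv ℝ f u)) u :=
    fun u hu => (hTd _ (hmaps hu.1)).differentiableAt.hasFDerivAt.comp u (hfd u hu.1)
  have hGbij : Bijective (fderiv ℝ (fun u => (((T ∘ f) u).1.1, ((T ∘ f) u).2)) a) := by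
    have h1 := hcd a ⟨ha, haΦ⟩
    have h2 : HasFDerivAt (fun u => (((T ∘ f) u).1.1, ((T ∘ f) u).2)) _ a :=
      h1.fst.fst.prodMk h1.snd
    have hin : Injective (fderiv ℝ (fun u => (((T ∘ f) u).1.1, ((T ∘ f) u).2)) a) := by
      rw [h2.fderiv, (hTd _ haΩ').fderiv, injective_iff_map_eq_zero]
      intro v hv
      have h3 : (L (dτ (df v))).1 = 0 := congrArg Prod.fst hv
      have h4 : π (df v) = 0 := congrArg Prod.snd hv
      have h5 : dτ (df v) = 0 := hL _ (Submodule.mem_map_of_mem ⟨v, rfl⟩) h3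
      have h6 : df v = 0 := hπ _ h5 h4
      exact hinj (h6.trans (map_zero (fderiv ℝ f a)).symm)
    refine ⟨hin, ?_⟩
    have hfin : finrank ℝ A = finrank ℝ (S × K) := by
      rw [finrank_prod]
      omega
    exact (LinearMap.injective_iff_surjective_of_finrank_eq_finrank
      (f := (fderiv ℝ (fun u => (((T ∘ f) u).1.1, ((T ∘ f) u).2)) a : A →ₗ[ℝ] S × K)) hfin).1 hin
  obtain ⟨U, hUΩ, hU, haU, B₁, B₂, h, hB₁, hB₂, hh, himage⟩ :=
    exists_image_eq_graph_prod (f := T ∘ f) hΩ₁ ⟨ha, haΦ⟩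
      (hTs.comp (hf.mono fun u hu => hu.1) (fun u hu => hmaps hu.1)) hGbij (by
        intro u hu k
        -- A vector along the factor `K` comes from a vector in the kernel of dτ, which is tangent
        -- to `f` by hypothesis.
        obtain ⟨w, hw⟩ := (hΦbij _ hu.2).2 ((0, 0), k)
        have h1 := hw
        rw [(hTd _ (hmaps hu.1)).fderiv] at h1
        have h2 : L (fderiv ℝ τ (f u) w) = 0 := congrArg Prod.fst h1
        obtain ⟨v, hv⟩ := hker u hu.1 w (by simpa using h2)
        exact ⟨v, by rw [(hcd u hu).fderiv]; simp [hv, hw]⟩)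
  -- The graph of `h` in the base is the zero set of `L₂ - h(L₁)`.
  refine ⟨U, fun u hu => (hUΩ hu).1, hU, haU, Φ.source ∩ Φ ⁻¹' {z | z.1.1 ∈ B₁ ∧ z.2 ∈ B₂},
    fun w hw => hΦΩ hw.1, ?_, {z | (L z).1 ∈ B₁}, fun z => (L z).2 - h (L z).1, ?_, ?_, ?_, ?_⟩
  · exact Φ.isOpen_inter_preimage ((hB₁.preimage (continuous_fst.comp continuous_fst)).inter
      (hB₂.preimage continuous_snd))
  · exact hB₁.preimage (continuous_fst.comp L.continuous)
  · exact L.contDiff.snd.contDiffOn.sub (hh.comp L.contDiff.fst.contDiffOn fun z hz => hz)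
  · intro z hz h0
    have h1 : HasFDerivAt h (fderiv ℝ h (L z).1) (L z).1 :=
      ((hh.contDiffAt (hB₁.mem_nhds hz)).differentiableAt (by simp)).hasFDerivAt
    have h2 : HasFDerivAt (fun z => L z) (L : C →L[ℝ] S × ℝ) z := L.hasFDerivAt
    have h3 := h2.snd.sub (h1.comp z h2.fst)
    have h4 : fderiv ℝ (fun z => (L z).2 - h (L z).1) z = _ := h3.fderiv
    rw [h4] at h0
    -- In the direction of the factor ℝ the term `h(L₁)` is constant, so the derivative of the
    -- defining function is 1 there.
    have h5 := congrArg (fun T : C →L[ℝ] ℝ => T (L.symm (0, 1))) h0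
    simp at h5
  · ext w
    constructor
    · rintro ⟨u, hu, rfl⟩
      have h1 : (T ∘ f) u ∈ (T ∘ f) '' U := mem_image_of_mem _ hu
      rw [himage] at h1
      refine ⟨⟨(hUΩ hu).2, ?_⟩, h1.1, ?_⟩
      · rw [mem_preimage, hΦ]
        exact ⟨h1.1, h1.2.1⟩
      · exact sub_eq_zero.2 h1.2.2
    · rintro ⟨⟨hw, hw'⟩, hw1, hw2⟩
      rw [mem_preimage, hΦ] at hw'
      have h1 : T w ∈ (T ∘ f) '' U := by
        rw [himage]
        exact ⟨hw'.1, hw'.2, sub_eq_zero.1 hw2⟩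
      obtain ⟨u, hu, hu'⟩ := h1
      refine ⟨u, hu, Φ.injOn (hUΩ hu).2 hw ?_⟩
      rw [hΦ]
      exact hu'

end NormalForm

/-! ### The twistor fibration -/

lemma toQuat_injective {z w z' w' : ℂ} (h : toQuat z w = toQuat z' w') : z = z' ∧ w = w' := by
  rw [Quaternion.ext_iff] at h
  exact ⟨Complex.ext h.1 h.2.1, Complex.ext h.2.2.1 h.2.2.2⟩

lemma exists_eq_toQuat (u : ℍ[ℝ]) : ∃ a b : ℂ, u = toQuat a b :=
  ⟨⟨u.re, u.imI⟩, ⟨u.imJ, u.imK⟩, rfl⟩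

/-- Left multiplication by the quaternion `a + b j`, in complex coordinates. -/
lemma toQuat_smul_add_jMul (a b : ℂ) (p : C4) :
    toQuat ((a • p + b • jMul p) 0) ((a • p + b • jMul p) 1) =
      toQuat a b * toQuat (p 0) (p 1) ∧
    toQuat ((a • p + b • jMul p) 2) ((a • p + b • jMul p) 3) =
      toQuat a b * toQuat (p 2) (p 3) := by
  constructor <;> (rw [Quaternion.ext_iff]; simp [jMul]; refine ⟨?_, ?_, ?_, ?_⟩ <;> ring)

/-- For u = a + bj, the conjugate of up times uq equals |u|² p̄q, and the squared norms also scale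
by |u|²; the factor cancels in the quotient. -/
lemma tauVec_smul_add_jMul (a b : ℂ) (h : toQuat a b ≠ 0) (p : C4) :
    tauVec (a • p + b • jMul p) = tauVec p := by
  have hu : Quaternion.normSq (toQuat a b) ≠ 0 := by simpa using h
  obtain ⟨h1, h2⟩ := toQuat_smul_add_jMul a b p
  have hm : star (toQuat a b * toQuat (p 0) (p 1)) * (toQuat a b * toQuat (p 2) (p 3)) =
      Quaternion.normSq (toQuat a b) • (star (toQuat (p 0) (p 1)) * toQuat (p 2) (p 3)) := by
    rw [star_mul, mul_assoc, ← mul_assoc (star (toQuat a b)), Quaternion.star_mul_self,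
      ← Quaternion.coe_mul_eq_smul, ← mul_assoc, ← mul_assoc, Quaternion.coe_commutes]
  ext k
  simp only [tauVec, h1, h2, hm, map_mul, ← mul_add, ← mul_sub, mul_inv, PiLp.smul_apply,
    smul_eq_mul]
  fin_cases k <;> simp <;> field_simp

/-- The fibres of the twistor fibration are the quaternionic lines. -/
lemma exists_eq_smul_add_jMul {v w : C4} (hv : v ≠ 0) (hw : w ≠ 0) (h : tauVec v = tauVec w) :
    ∃ a b : ℂ, w = a • v + b • jMul v := by
  have hn := normSq_add_ne_zero v hv
  have hn' := normSq_add_ne_zero w hw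
  set P := toQuat (v 0) (v 1)
  set Q := toQuat (v 2) (v 3)
  set P' := toQuat (w 0) (w 1)
  set Q' := toQuat (w 2) (w 3)
  set n := Quaternion.normSq P + Quaternion.normSq Q
  set n' := Quaternion.normSq P' + Quaternion.normSq Q'
  have hk : ∀ k, tauVec v k = tauVec w k := fun k => by rw [h]
  have h0 : n⁻¹ * (Quaternion.normSq P - Quaternion.normSq Q) =
      n'⁻¹ * (Quaternion.normSq P' - Quaternion.normSq Q') := hk 0
  have hm : n⁻¹ • (star P * Q) = n'⁻¹ • (star P' * Q') := by
    have h1 : n⁻¹ * (2 * (star P * Q).re) = n'⁻¹ * (2 * (star P' * Q').re) := hk 1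
    have h2 : n⁻¹ * (2 * (star P * Q).imI) = n'⁻¹ * (2 * (star P' * Q').imI) := hk 2
    have h3 : n⁻¹ * (2 * (star P * Q).imJ) = n'⁻¹ * (2 * (star P' * Q').imJ) := hk 3
    have h4 : n⁻¹ * (2 * (star P * Q).imK) = n'⁻¹ * (2 * (star P' * Q').imK) := hk 4
    rw [Quaternion.ext_iff]
    simp only [Quaternion.re_smul, Quaternion.imI_smul, Quaternion.imJ_smul, Quaternion.imK_smul,
      smul_eq_mul]
    refine ⟨?_, ?_, ?_, ?_⟩ <;> linarith
  have hm' : n⁻¹ • (star Q * P) = n'⁻¹ • (star Q' * P') := by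
    simpa using congrArg star hm
  have hP : n⁻¹ * Quaternion.normSq P = n'⁻¹ * Quaternion.normSq P' := by
    have e1 : n⁻¹ * (Quaternion.normSq P + Quaternion.normSq Q) = 1 := inv_mul_cancel₀ hn
    have e2 : n'⁻¹ * (Quaternion.normSq P' + Quaternion.normSq Q') = 1 := inv_mul_cancel₀ hn'
    linarith
  have hQ : n⁻¹ * Quaternion.normSq Q = n'⁻¹ * Quaternion.normSq Q' := by linarith
  have hsum : n'⁻¹ * Quaternion.normSq P' + n'⁻¹ * Quaternion.normSq Q' = 1 := by
    rw [← mul_add]; exact inv_mul_cancel₀ hn'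
  -- If w = uv for a quaternion u, then multiplying by the conjugate transpose of v forces u = n⁻¹
  -- (P' P̄ + Q' Q̄). The equalities extracted from `h` show that this u works.
  obtain ⟨a, b, hab⟩ := exists_eq_toQuat (n⁻¹ • (P' * star P + Q' * star Q))
  have huP : toQuat a b * P = P' := by
    have e1 : toQuat a b * P = P' * (n⁻¹ • (star P * P)) + Q' * (n⁻¹ • (star Q * P)) := by
      rw [← hab, smul_mul_assoc, add_mul, smul_add, mul_smul_comm, mul_smul_comm, mul_assoc,
        mul_assoc]
    rw [e1, hm', Quaternion.star_mul_self, mul_smul_comm, mul_smul_comm, ← mul_assoc,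
      Quaternion.self_mul_star, Quaternion.mul_coe_eq_smul, Quaternion.coe_mul_eq_smul, smul_smul,
      smul_smul, hP, ← add_smul, hsum, one_smul]
  have huQ : toQuat a b * Q = Q' := by
    have e1 : toQuat a b * Q = P' * (n⁻¹ • (star P * Q)) + Q' * (n⁻¹ • (star Q * Q)) := by
      rw [← hab, smul_mul_assoc, add_mul, smul_add, mul_smul_comm, mul_smul_comm, mul_assoc,
        mul_assoc]
    rw [e1, hm, Quaternion.star_mul_self, mul_smul_comm, mul_smul_comm, ← mul_assoc,
      Quaternion.self_mul_star, Quaternion.mul_coe_eq_smul, Quaternion.coe_mul_eq_smul, smul_smul,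
      smul_smul, hQ, ← add_smul, hsum, one_smul]
  obtain ⟨h1, h2⟩ := toQuat_smul_add_jMul a b v
  have h3 := toQuat_injective (h1.trans huP)
  have h4 := toQuat_injective (h2.trans huQ)
  refine ⟨a, b, ?_⟩
  ext k
  fin_cases k
  · exact h3.1.symm
  · exact h3.2.symm
  · exact h4.1.symm
  · exact h4.2.symm

lemma tau_proj {v : C4} (hv : v ≠ 0) : (tau (proj v) : EuclideanSpace ℝ (Fin 5)) = tauVec v := by
  rw [proj_of_ne hv]
  rfl

/-! ### Smoothness of the twistor fibration -/

lemma contDiff_re (i : Fin 4) : ContDiff ℝ ∞ (fun v : C4 => (v i).re) :=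
  Complex.reCLM.contDiff.comp (contDiff_coord i)

lemma contDiff_im (i : Fin 4) : ContDiff ℝ ∞ (fun v : C4 => (v i).im) :=
  Complex.imCLM.contDiff.comp (contDiff_coord i)

lemma contDiffOn_tauVec : ContDiffOn ℝ ∞ tauVec {v | v ≠ 0} := by
  have hr := contDiff_re
  have hi := contDiff_im
  have hn : ContDiff ℝ ∞ (fun v : C4 =>
      Quaternion.normSq (toQuat (v 0) (v 1)) + Quaternion.normSq (toQuat (v 2) (v 3))) := by
    simp only [Quaternion.normSq_def', toQuat_re, toQuat_imI, toQuat_imJ, toQuat_imK]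
    fun_prop
  refine (hn.contDiffOn.inv fun v hv => normSq_add_ne_zero v hv).smul (ContDiff.contDiffOn ?_)
  rw [contDiff_euclidean]
  intro k
  fin_cases k <;>
  · simp [Quaternion.normSq_def']
    fun_prop

lemma contMDiff_tau : ContMDiff 𝓘(ℝ, C3) (𝓡 4) ∞ tau := by
  have h : ContMDiff 𝓘(ℝ, C3) 𝓘(ℝ, EuclideanSpace ℝ (Fin 5)) ∞
      (fun x => (tau x : EuclideanSpace ℝ (Fin 5))) := by
    intro x
    obtain ⟨i, hi⟩ := exists_mem_affineDomain x
    have h1 : ContMDiffAt 𝓘(ℝ, C3) 𝓘(ℝ, C3) ∞ (affineChart i) x :=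
      contMDiffAt_of_mem_maximalAtlas (IsManifold.subset_maximalAtlas (mem_range_self i)) hi
    have h2 : ContDiff ℝ ∞ (fun w => tauVec (unaffine i w)) :=
      contDiffOn_univ.1 (contDiffOn_tauVec.comp (contDiff_unaffine i).contDiffOn
        fun w _ => unaffine_ne_zero i w)
    refine (h2.contMDiff.contMDiffAt.comp x h1).congr_of_eventuallyEq ?_
    filter_upwards [(isOpen_affineDomain i).mem_nhds hi] with y hy
    have h3 := (affineChart i).left_inv hy
    have h4 : y = proj (unaffine i (affineChart i y)) := by
      rw [proj_of_ne (unaffine_ne_zero i _)]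
      exact h3.symm
    conv_lhs => rw [h4]
    exact tau_proj (unaffine_ne_zero i _)
  have : Fact (finrank ℝ (EuclideanSpace ℝ (Fin 5)) = 4 + 1) := ⟨finrank_euclideanSpace_fin⟩
  exact h.codRestrict_sphere fun x => (tau x).2

lemma contMDiff_coe_S4 : ContMDiff (𝓡 4) 𝓘(ℝ, EuclideanSpace ℝ (Fin 5)) ∞
    ((↑) : S4 → EuclideanSpace ℝ (Fin 5)) :=
  have : Fact (finrank ℝ (EuclideanSpace ℝ (Fin 5)) = 4 + 1) := ⟨finrank_euclideanSpace_fin⟩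
  contMDiff_coe_sphere

lemma injective_mfderiv_coe_S4 (y : S4) : Injective (mfderiv (𝓡 4)
    𝓘(ℝ, EuclideanSpace ℝ (Fin 5)) ((↑) : S4 → EuclideanSpace ℝ (Fin 5)) y) :=
  have : Fact (finrank ℝ (EuclideanSpace ℝ (Fin 5)) = 4 + 1) := ⟨finrank_euclideanSpace_fin⟩
  injective_mvfderiv_subtypeVal_sphere y

/-! ### The differential of the twistor fibration -/

/-- The numerator of `tauVec`. -/
noncomputable def tauNum (v : C4) : EuclideanSpace ℝ (Fin 5) :=
  let p := toQuat (v 0) (v 1)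
  let q := toQuat (v 2) (v 3)
  let m := star p * q
  !₂[Quaternion.normSq p - Quaternion.normSq q, 2 * m.re, 2 * m.imI, 2 * m.imJ, 2 * m.imK]

lemma tauVec_eq (v : C4) : tauVec v = (‖v‖ ^ 2)⁻¹ • tauNum v := by
  have : ‖v‖ ^ 2 =
      Quaternion.normSq (toQuat (v 0) (v 1)) + Quaternion.normSq (toQuat (v 2) (v 3)) := by
    rw [EuclideanSpace.norm_sq_eq, Fin.sum_univ_four]
    simp only [Quaternion.normSq_def', toQuat_re, toQuat_imI, toQuat_imJ, toQuat_imK,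
      ← Complex.normSq_eq_norm_sq, Complex.normSq_apply]
    ring
  rw [this]
  rfl

/-- The polarization of the quadratic map `tauNum`. -/
noncomputable def tauPolar (p v : C4) : EuclideanSpace ℝ (Fin 5) :=
  tauNum (p + v) - tauNum p - tauNum v

lemma tauNum_add_smul (p v : C4) (t : ℝ) :
    tauNum (p + t • v) = tauNum p + t • tauPolar p v + t ^ 2 • tauNum v := by
  ext k
  fin_cases k <;>
  · simp [tauNum, tauPolar, Quaternion.normSq_def']
    ring

/-- On `liftD2 p` the three inner products vanish and the length is 2‖p‖‖v‖. Hence the twistor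
fibration is a homothety on `D2`, in particular injective there. -/
lemma norm_sq_tauPolar (p v : C4) :
    ‖tauPolar p v‖ ^ 2 = 4 * ‖p‖ ^ 2 * ‖v‖ ^ 2 -
      4 * (⟪iMul p, v⟫_ℝ ^ 2 + ⟪jMul p, v⟫_ℝ ^ 2 + ⟪kMul p, v⟫_ℝ ^ 2) := by
  simp only [EuclideanSpace.norm_sq_eq, Fin.sum_univ_four, Fin.sum_univ_five,
    ← Complex.normSq_eq_norm_sq, Complex.normSq_apply, PiLp.inner_apply, Real.norm_eq_abs, sq_abs]
  simp [tauNum, tauPolar, Quaternion.normSq_def', kMul, jMul, iMul, Complex.inner]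
  ring

lemma hasFDerivAt_tauVec {p : C4} (hp : p ≠ 0) : HasFDerivAt tauVec (fderiv ℝ tauVec p) p :=
  ((contDiffOn_tauVec.contDiffAt (isOpen_ne.mem_nhds hp)).differentiableAt (by simp)).hasFDerivAt

lemma hasDerivAt_add_smul (p v : C4) : HasDerivAt (fun t : ℝ => p + t • v) v 0 := by
  simpa using ((hasDerivAt_id (0 : ℝ)).smul_const v).const_add p

lemma hasDerivAt_tauVec_add_smul {p : C4} (hp : p ≠ 0) (v : C4) :
    HasDerivAt (fun t : ℝ => tauVec (p + t • v)) (fderiv ℝ tauVec p v) 0 := by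
  have h := hasFDerivAt_tauVec hp
  have h1 : HasFDerivAt tauVec (fderiv ℝ tauVec p) (p + (0 : ℝ) • v) := by simpa using h
  exact h1.comp_hasDerivAt (0 : ℝ) (hasDerivAt_add_smul p v)

/-- The line p + t c jp consists of the multiples (1 + t c j)p of p, so it stays in one quaternionic
line, where `tauVec` is constant. The real part 1 keeps the multiplier nonzero. -/
lemma fderiv_tauVec_eq_zero_of_mem_liftD1 {p : C4} (hp : p ≠ 0) {v : C4} (hv : v ∈ liftD1 p) :
    fderiv ℝ tauVec p v = 0 := by
  rw [liftD1_eq] at hv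
  obtain ⟨c, rfl⟩ := Submodule.mem_span_singleton.1 hv
  refine (hasDerivAt_tauVec_add_smul hp (c • jMul p)).unique ?_
  have : (fun t : ℝ => tauVec (p + t • c • jMul p)) = fun _ => tauVec p := by
    funext t
    have h := tauVec_smul_add_jMul 1 (t * c) (fun h => ?_) p
    · rw [one_smul, mul_smul] at h
      exact h
    · have := congrArg QuaternionAlgebra.re h
      simp at this
  rw [this]
  exact hasDerivAt_const _ _

/-- Since v is orthogonal to p, ‖p + tv‖² has no linear term in t, and only the numerator
contributes to the derivative. -/
lemma fderiv_tauVec_of_mem_liftD2 {p : C4} (hp : p ≠ 0) {v : C4} (hv : v ∈ liftD2 p) :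
    fderiv ℝ tauVec p v = (‖p‖ ^ 2)⁻¹ • tauPolar p v := by
  have hpv : ⟪p, v⟫_ℝ = 0 := hv p (Submodule.subset_span (by simp))
  refine (hasDerivAt_tauVec_add_smul hp v).unique ?_
  have h1 : (fun t : ℝ => tauVec (p + t • v)) = fun t : ℝ => (‖p‖ ^ 2 + t ^ 2 * ‖v‖ ^ 2)⁻¹ •
      (tauNum p + t • tauPolar p v + t ^ 2 • tauNum v) := by
    funext t
    rw [tauVec_eq, tauNum_add_smul, @norm_add_sq_real, inner_smul_right, hpv, norm_smul, mul_pow]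
    simp
  have hid := hasDerivAt_id (0 : ℝ)
  have h2 : HasDerivAt (fun t : ℝ => ‖p‖ ^ 2 + t ^ 2 * ‖v‖ ^ 2) 0 0 := by
    simpa using ((hid.pow 2).mul_const (‖v‖ ^ 2)).const_add (‖p‖ ^ 2)
  have h3 : HasDerivAt (fun t : ℝ => (‖p‖ ^ 2 + t ^ 2 * ‖v‖ ^ 2)⁻¹) 0 0 := by
    have := h2.inv (by simpa using hp)
    simp only [neg_zero, zero_div] at this
    exact this
  have h4 : HasDerivAt (fun t : ℝ => tauNum p + t • tauPolar p v + t ^ 2 • tauNum v)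
      (tauPolar p v) 0 := by
    have := ((hid.smul_const (tauPolar p v)).const_add (tauNum p)).add
      ((hid.pow 2).smul_const (tauNum v))
    simp only [one_smul, id_eq, Nat.add_one_sub_one, pow_one, mul_zero, zero_mul, zero_smul,
      add_zero] at this
    exact this
  rw [h1]
  have := h3.smul h4
  simp only [zero_smul, add_zero, ne_eq, OfNat.ofNat_ne_zero, not_false_eq_true, zero_pow,
    zero_mul] at this
  exact this

lemma eq_zero_of_fderiv_tauVec_eq_zero {p : C4} (hp : p ≠ 0) {v : C4} (hv : v ∈ liftD2 p)
    (h : fderiv ℝ tauVec p v = 0) : v = 0 := by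
  have hp' : ‖p‖ ^ 2 ≠ 0 := pow_ne_zero 2 (norm_ne_zero_iff.2 hp)
  rw [fderiv_tauVec_of_mem_liftD2 hp hv, smul_eq_zero_iff_right (inv_ne_zero hp')] at h
  have h1 := norm_sq_tauPolar p v
  rw [h, hv (iMul p) (Submodule.subset_span (by simp)),
    hv (jMul p) (Submodule.subset_span (by simp)),
    hv (kMul p) (Submodule.subset_span (by simp))] at h1
  simpa [hp] using h1

lemma hasMFDerivAt_proj {p : C4} (hp : p ≠ 0) :
    HasMFDerivAt 𝓘(ℝ, C4) 𝓘(ℝ, C3) proj p (dproj p) := by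
  obtain ⟨i, -, h⟩ := exists_hasMFDerivAt_proj p hp
  exact h.mdifferentiableAt.hasMFDerivAt

lemma hasMFDerivAt_tau (x : CP3) :
    HasMFDerivAt 𝓘(ℝ, C3) (𝓡 4) tau x (mfderiv 𝓘(ℝ, C3) (𝓡 4) tau x) :=
  ((contMDiff_tau x).mdifferentiableAt (by simp)).hasMFDerivAt

/-- The inclusion of S⁴ in ℝ⁵ is an immersion, so the kernel of dτ can be computed from the explicit
map `tauVec`. -/
lemma mfderiv_tau_dproj_eq_zero_iff {p : C4} (hp : p ≠ 0) (v : C4) :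
    mfderiv 𝓘(ℝ, C3) (𝓡 4) tau (proj p) (dproj p v) = 0 ↔ fderiv ℝ tauVec p v = 0 := by
  have h1 := HasMFDerivAt.comp p (hasMFDerivAt_tau (proj p)) (hasMFDerivAt_proj hp)
  have h2 : HasMFDerivAt (𝓡 4) 𝓘(ℝ, EuclideanSpace ℝ (Fin 5))
      ((↑) : S4 → EuclideanSpace ℝ (Fin 5)) (tau (proj p)) _ :=
    ((contMDiff_coe_S4 (tau (proj p))).mdifferentiableAt (by simp)).hasMFDerivAt
  have h3 := HasMFDerivAt.comp p h2 h1
  have h4 : HasMFDerivAt 𝓘(ℝ, C4) 𝓘(ℝ, EuclideanSpace ℝ (Fin 5)) _ p _ :=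
    (hasFDerivAt_tauVec hp).hasMFDerivAt
  have h5 : tauVec =ᶠ[𝓝 p] ((↑) : S4 → EuclideanSpace ℝ (Fin 5)) ∘ tau ∘ proj := by
    filter_upwards [isOpen_ne.mem_nhds hp] with v hv
    exact (tau_proj hv).symm
  have h6 := hasMFDerivAt_unique h4 (h3.congr_of_eventuallyEq h5)
  have h7 : fderiv ℝ tauVec p v = mfderiv (𝓡 4) 𝓘(ℝ, EuclideanSpace ℝ (Fin 5))
      ((↑) : S4 → EuclideanSpace ℝ (Fin 5)) (tau (proj p))
      (mfderiv 𝓘(ℝ, C3) (𝓡 4) tau (proj p) (dproj p v)) := by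
    rw [h6]
    rfl
  rw [h7]
  constructor
  · intro h
    rw [h, map_zero]
    rfl
  · intro h
    exact injective_mfderiv_coe_S4 (tau (proj p)) (h.trans (map_zero _).symm)

instance instFiniteDimensionalT (x : CP3) : FiniteDimensional ℝ (T x) :=
  inferInstanceAs (FiniteDimensional ℝ C3)

lemma finrank_T (x : CP3) : finrank ℝ (T x) = 6 := by
  change finrank ℝ (Fin 3 → ℂ) = 6
  rw [finrank_pi_fintype]
  simp [Complex.finrank_real_complex]

/-- The distribution `𝒟₁²` is tangent to the fibres of the twistor fibration. -/
lemma mfderiv_tau_eq_zero_iff (x : CP3) (X : T x) :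
    mfderiv 𝓘(ℝ, C3) (𝓡 4) tau x X = 0 ↔ X ∈ D1 x := by
  have key : ∀ v, mfderiv 𝓘(ℝ, C3) (𝓡 4) tau x (dHopf x v) = 0 ↔
      fderiv ℝ tauVec (unitRep x) v = 0 := by
    intro v
    have h := mfderiv_tau_dproj_eq_zero_iff (unitRep_ne_zero x) v
    have hx := proj_unitRep x
    have gen : ∀ y : CP3, y = x → (mfderiv 𝓘(ℝ, C3) (𝓡 4) tau y (dproj (unitRep x) v) = 0 ↔
        mfderiv 𝓘(ℝ, C3) (𝓡 4) tau x (dHopf x v) = 0) := by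
      rintro _ rfl
      rfl
    rw [← gen _ hx, h]
  constructor
  · intro h
    have hX : X ∈ D1 x ⊔ D2 x := by rw [D1_sup_D2]; trivial
    obtain ⟨Y, ⟨v, hv, rfl⟩, Z, ⟨w, hw, rfl⟩, rfl⟩ := Submodule.mem_sup.1 hX
    have h1 := (key v).2 (fderiv_tauVec_eq_zero_of_mem_liftD1 (unitRep_ne_zero x) hv)
    rw [map_add, h1, zero_add, key] at h
    rw [eq_zero_of_fderiv_tauVec_eq_zero (unitRep_ne_zero x) hw h, map_zero, add_zero]
    exact Submodule.mem_map_of_mem hv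
  · rintro ⟨v, hv, rfl⟩
    exact (key v).2 (fderiv_tauVec_eq_zero_of_mem_liftD1 (unitRep_ne_zero x) hv)

lemma finrank_D1_le (x : CP3) : finrank ℝ (D1 x) ≤ 2 := by
  refine (Submodule.finrank_map_le _ _).trans ?_
  classical
  have := finrank_span_finset_le_card (R := ℝ) ({jMul (unitRep x), kMul (unitRep x)} : Finset C4)
  rw [Finset.coe_pair] at this
  exact this.trans Finset.card_le_two

/-- The kernel is `D1`, spanned by two vectors, so the rank is at least 6 - 2 = 4, the dimension of
S⁴. -/
lemma surjective_mfderiv_tau (x : CP3) : Surjective (mfderiv 𝓘(ℝ, C3) (𝓡 4) tau x) := by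
  let L : T x →ₗ[ℝ] EuclideanSpace ℝ (Fin 4) :=
    (mfderiv 𝓘(ℝ, C3) (𝓡 4) tau x : T x →L[ℝ] TangentSpace (𝓡 4) (tau x)).toLinearMap
  have h1 : LinearMap.ker L = D1 x := by
    ext X
    exact mfderiv_tau_eq_zero_iff x X
  have h2 := L.finrank_range_add_finrank_ker
  rw [h1, finrank_T] at h2
  have h3 := finrank_D1_le x
  have h4 : finrank ℝ (LinearMap.range L) ≤ 4 := by
    simpa using (LinearMap.range L).finrank_le
  have h5 : LinearMap.range L = ⊤ := Submodule.eq_top_of_finrank_eq (by simp; omega)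
  exact LinearMap.range_eq_top.1 h5

/-- Rank–nullity read backwards: surjectivity of dτ forces its kernel to have dimension exactly 6 -
4. -/
lemma finrank_D1 (x : CP3) : finrank ℝ (D1 x) = 2 := by
  let L : T x →ₗ[ℝ] EuclideanSpace ℝ (Fin 4) :=
    (mfderiv 𝓘(ℝ, C3) (𝓡 4) tau x : T x →L[ℝ] TangentSpace (𝓡 4) (tau x)).toLinearMap
  have h1 : LinearMap.ker L = D1 x := by
    ext X
    exact mfderiv_tau_eq_zero_iff x X
  have h2 := L.finrank_range_add_finrank_ker
  have h3 : LinearMap.range L = ⊤ := LinearMap.range_eq_top.2 (surjective_mfderiv_tau x)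
  rw [h1, finrank_T, h3, finrank_top, finrank_euclideanSpace_fin] at h2
  omega

/-- The fibre through [p] is the image of ℂ² ∖ {0} under (a, b) ↦ [ap + b jp], and removing a point
from a real vector space of dimension greater than one leaves it connected. -/
lemma isPreconnected_preimage_tau (y : S4) : IsPreconnected (tau ⁻¹' {y}) := by
  rcases (tau ⁻¹' {y}).eq_empty_or_nonempty with h | ⟨x, rfl⟩
  · rw [h]
    exact isPreconnected_empty
  have hx0 := unitRep_ne_zero x
  -- The vectors p and jp are nonzero and Hermitian orthogonal, hence linearly independent over ℂ.
  have hlin : ∀ z : ℂ × ℂ, z ≠ 0 → z.1 • unitRep x + z.2 • jMul (unitRep x) ≠ 0 := by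
    intro z hz h
    have h1 := congrArg (fun v => ⟪unitRep x, v⟫_ℂ) h
    have h2 := congrArg (fun v => ⟪jMul (unitRep x), v⟫_ℂ) h
    simp only [inner_add_right, inner_smul_right, inner_jMul, inner_zero_right, mul_zero,
      add_zero] at h1 h2
    have h3 : z.1 = 0 := by simpa [hx0] using h1
    have h4 : jMul (unitRep x) ≠ 0 := by
      intro h0
      apply hx0
      have e : ∀ k, jMul (unitRep x) k = 0 := fun k => by rw [h0]; rfl
      ext k
      fin_cases k
      · simpa [jMul] using e 1
      · simpa [jMul] using e 0
      · simpa [jMul] using e 3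
      · simpa [jMul] using e 2
    have h5 : z.2 = 0 := by simpa [h3, h4] using h2
    exact hz (Prod.ext h3 h5)
  have himage : tau ⁻¹' {tau x} =
      (fun z : ℂ × ℂ => proj (z.1 • unitRep x + z.2 • jMul (unitRep x))) '' {0}ᶜ := by
    ext y
    constructor
    · intro hy
      have h1 : tauVec (unitRep x) = tauVec (unitRep y) := by
        rw [← tau_proj hx0, ← tau_proj (unitRep_ne_zero y), proj_unitRep, proj_unitRep]
        exact congrArg _ hy.symm
      obtain ⟨a, b, hab⟩ := exists_eq_smul_add_jMul hx0 (unitRep_ne_zero y) h1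
      refine ⟨(a, b), ?_, ?_⟩
      · intro h0
        obtain ⟨rfl, rfl⟩ := Prod.ext_iff.1 h0
        exact unitRep_ne_zero y (by rw [hab]; simp)
      · simp only
        rw [← hab, proj_unitRep]
    · rintro ⟨z, hz, rfl⟩
      refine Subtype.ext ?_
      rw [tau_proj (hlin z hz), tauVec_smul_add_jMul _ _ ?_, ← tau_proj hx0, proj_unitRep]
      intro h
      obtain ⟨h1, h2⟩ := toQuat_injective (h.trans (show (0 : ℍ[ℝ]) = toQuat 0 0 from rfl))
      exact hz (Prod.ext h1 h2)
  rw [himage]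
  refine IsPreconnected.image ?_ _ ?_
  · refine (isConnected_compl_singleton_of_one_lt_rank ?_ (0 : ℂ × ℂ)).isPreconnected
    rw [← finrank_eq_rank]
    simp [Complex.finrank_real_complex]
  · intro z hz
    refine ContinuousAt.continuousWithinAt ?_
    exact (continuousAt_proj _ (hlin z hz)).comp (f := fun z : ℂ × ℂ =>
      z.1 • unitRep x + z.2 • jMul (unitRep x)) (by fun_prop)

/-! ### Linear algebra of the nearly Kähler structure -/

lemma hopfLift_mem (x : CP3) (X : T x) : hopfLift x X ∈ hopfHorizontal (unitRep x) :=
  ((hopfIso x).symm X).2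

lemma dHopf_hopfLift (x : CP3) (X : T x) : dHopf x (hopfLift x X) = X :=
  (hopfIso x).apply_symm_apply X

lemma hopfLift_injective (x : CP3) : Injective (hopfLift x) :=
  LeftInverse.injective (dHopf_hopfLift x)

lemma hopfLift_J1 (x : CP3) (X : T x) : hopfLift x (J1 x X) = iMul (hopfLift x X) :=
  hopfLift_dHopf x _ (smul_mem_hopfHorizontal _ (hopfLift_mem x X))

lemma reflection_mem_hopfHorizontal {p v : C4} (hv : v ∈ hopfHorizontal p) :
    (liftD1 p)ᗮ.reflection v ∈ hopfHorizontal p := by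
  obtain ⟨a, ha, b, hb, rfl⟩ := (liftD1 p).exists_add_mem_mem_orthogonal v
  have hb' : b ∈ hopfHorizontal p := by
    simpa using Submodule.sub_mem _ hv (liftD1_le _ ha)
  rw [map_add, Submodule.reflection_mem_subspace_orthogonal_precomplement_eq_neg ha,
    Submodule.reflection_mem_subspace_eq_self hb]
  exact Submodule.add_mem _ (Submodule.neg_mem _ (liftD1_le _ ha)) hb'

/-- Both `liftD1 p` and its orthogonal complement are complex subspaces. This is the source of the
commutation of `P` with `J1`. -/
lemma reflection_iMul (p v : C4) :
    (liftD1 p)ᗮ.reflection (iMul v) = iMul ((liftD1 p)ᗮ.reflection v) := by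
  obtain ⟨a, ha, b, hb, rfl⟩ := (liftD1 p).exists_add_mem_mem_orthogonal v
  have ha' : iMul a ∈ liftD1 p := smul_mem_liftD1 Complex.I ha
  have hb' : iMul b ∈ (liftD1 p)ᗮ := smul_mem_liftD1_orthogonal Complex.I hb
  rw [map_add, map_add, map_add,
    Submodule.reflection_mem_subspace_orthogonal_precomplement_eq_neg ha,
    Submodule.reflection_mem_subspace_orthogonal_precomplement_eq_neg ha',
    Submodule.reflection_mem_subspace_eq_self hb, Submodule.reflection_mem_subspace_eq_self hb',
    map_add, map_neg]

lemma hopfLift_P (x : CP3) (X : T x) :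
    hopfLift x (P x X) = (liftD1 (unitRep x))ᗮ.reflection (hopfLift x X) :=
  hopfLift_dHopf x _ (reflection_mem_hopfHorizontal (hopfLift_mem x X))

lemma P_P (x : CP3) (X : T x) : P x (P x X) = X := by
  apply hopfLift_injective
  rw [hopfLift_P, hopfLift_P, Submodule.reflection_reflection]

lemma J1_J1 (x : CP3) (X : T x) : J1 x (J1 x X) = -X := by
  apply hopfLift_injective
  rw [hopfLift_J1, hopfLift_J1, map_neg]
  change Complex.I • Complex.I • hopfLift x X = _
  rw [smul_smul, Complex.I_mul_I, neg_one_smul]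

lemma P_J1 (x : CP3) (X : T x) : P x (J1 x X) = J1 x (P x X) := by
  apply hopfLift_injective
  rw [hopfLift_P, hopfLift_J1, hopfLift_J1, hopfLift_P, reflection_iMul]

lemma g1_comm (x : CP3) (X Y : T x) : g1 x X Y = g1 x Y X := real_inner_comm _ _

lemma g1_P_P (x : CP3) (X Y : T x) : g1 x (P x X) (P x Y) = g1 x X Y := by
  rw [g1, hopfLift_P, hopfLift_P, LinearIsometryEquiv.inner_map_map]
  rfl

lemma g1_J1_J1 (x : CP3) (X Y : T x) : g1 x (J1 x X) (J1 x Y) = g1 x X Y := by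
  rw [g1, hopfLift_J1, hopfLift_J1]
  change ⟪Complex.I • hopfLift x X, Complex.I • hopfLift x Y⟫_ℝ = ⟪hopfLift x X, hopfLift x Y⟫_ℝ
  rw [inner_real_eq, inner_real_eq, inner_smul_left, inner_smul_right, ← mul_assoc]
  simp

/-- The nearly Kähler metric as a bilinear form. -/
noncomputable def gForm (x : CP3) : T x →ₗ[ℝ] T x →ₗ[ℝ] ℝ :=
  LinearMap.mk₂ ℝ (g x)
    (fun X X' Y => by simp only [g, g1, map_add, inner_add_left]; ring)
    (fun c X Y => by simp only [g, g1, map_smul, real_inner_smul_left, smul_eq_mul]; ring)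
    (fun X Y Y' => by simp only [g, g1, map_add, inner_add_right]; ring)
    (fun c X Y => by simp only [g, g1, map_smul, real_inner_smul_right, smul_eq_mul]; ring)

lemma gForm_apply (x : CP3) (X Y : T x) : gForm x X Y = g x X Y := rfl

lemma g1_P_left (x : CP3) (X Y : T x) : g1 x (P x X) Y = g1 x X (P x Y) := by
  rw [← g1_P_P, P_P]

lemma g_comm (x : CP3) (X Y : T x) : g x X Y = g x Y X := by
  rw [g, g, g1_comm x X Y, ← g1_P_left x X Y, g1_comm x (P x X) Y]

lemma g_P_left (x : CP3) (X Y : T x) : g x (P x X) Y = g x X (P x Y) := by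
  rw [g, g, g1_P_left, g1_P_left]

lemma g_J1_J1 (x : CP3) (X Y : T x) : g x (J1 x X) (J1 x Y) = g x X Y := by
  rw [g, g, P_J1, g1_J1_J1, g1_J1_J1]

lemma g_J1_left (x : CP3) (X Y : T x) : g x (J1 x X) Y = -g x X (J1 x Y) := by
  rw [← g_J1_J1 x X, J1_J1, ← gForm_apply, ← gForm_apply, map_neg, neg_neg]

lemma g_P_P (x : CP3) (X Y : T x) : g x (P x X) (P x Y) = g x X Y := by
  rw [g_P_left, P_P]

/-- From 0 ≤ |X + PX|² = 2 (g₁(X, X) + g₁(X, PX)) one gets g(X, X) ≥ g₁(X, X). -/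
lemma g_self_pos (x : CP3) {X : T x} (hX : X ≠ 0) : 0 < g x X X := by
  have h1 : 0 < g1 x X X :=
    real_inner_self_pos.2 fun h => hX (hopfLift_injective x (h.trans (map_zero _).symm))
  have h2 : 0 ≤ g1 x (X + P x X) (X + P x X) := real_inner_self_nonneg
  have h3 : g1 x (X + P x X) (X + P x X) = 2 * g1 x X X + 2 * g1 x X (P x X) := by
    have e1 := g1_P_P x X X
    have e2 := g1_P_left x X X
    simp only [g1, map_add, inner_add_left, inner_add_right] at *
    rw [e1, e2]
    ring
  rw [g]
  linarith

lemma eq_zero_of_g_self {x : CP3} {X : T x} (h : g x X X = 0) : X = 0 := by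
  by_contra hX
  exact (g_self_pos x hX).ne' h

lemma g_N_J1 (x : CP3) (N : T x) : g x N (J1 x N) = 0 := by
  have h := g_J1_left x N N
  rw [g_comm] at h
  linarith

/-- `P` is self-adjoint and commutes with the skew-adjoint `J1`, so their product is skew-adjoint.
-/
lemma g_P_J1 (x : CP3) (N : T x) : g x (P x N) (J1 x N) = 0 := by
  have h := g_J1_left x (P x N) N
  rw [← P_J1, g_P_left, g_comm] at h
  linarith

lemma J_apply (x : CP3) (X : T x) : J x X = P x (J1 x X) := rfl

lemma P_eq_or_of_P_eq_smul {x : CP3} {N : T x} (hN : N ≠ 0) {a : ℝ} (h : P x N = a • N) :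
    P x N = N ∨ P x N = -N := by
  have h1 := P_P x N
  rw [h, map_smul, h, smul_smul] at h1
  have h2 : (a * a - 1) • N = 0 := by rw [sub_smul, h1, one_smul, sub_self]
  have h3 : a * a = 1 := by
    rcases smul_eq_zero.1 h2 with h3 | h3
    · linarith
    · exact absurd h3 hN
  rcases mul_self_eq_one_iff.1 h3 with rfl | rfl
  · left; rw [h, one_smul]
  · right; rw [h, neg_one_smul]

lemma ne_zero_of_g_self {x : CP3} {N : T x} (hN : g x N N = 1) : N ≠ 0 := by
  rintro rfl
  rw [← gForm_apply] at hN
  simp at hN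

/-- The equality case of Cauchy–Schwarz for the unit vectors N and PN: the squared length of PN - N
is 2 - 2 g(N, PN). -/
lemma P_eq_self_of_one_le {x : CP3} {N : T x} (hN : g x N N = 1) (h : 1 ≤ g x N (P x N)) :
    P x N = N := by
  have h1 : g x (P x N - N) (P x N - N) = 2 - 2 * g x N (P x N) := by
    have e1 := g_P_P x N N
    have e2 := g_comm x (P x N) N
    simp only [← gForm_apply, map_sub, LinearMap.sub_apply] at *
    linarith
  by_contra h2
  have := g_self_pos x (sub_ne_zero.2 h2)
  linarith

lemma angle_eq_zero_iff {x : CP3} {N : T x} (hN : g x N N = 1) :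
    angle x N = 0 ↔ P x N = N := by
  -- `Real.arccos` vanishes on all of [1, ∞), so a zero angle gives only the inequality 1 ≤ g(N,
  -- PN).
  rw [angle, div_eq_zero_iff, or_iff_left two_ne_zero, Real.arccos_eq_zero]
  exact ⟨P_eq_self_of_one_le hN, fun h => by rw [h, hN]⟩

lemma finrank_span_pair_J1 {x : CP3} {N : T x} (hN : g x N N = 1) :
    finrank ℝ (Submodule.span ℝ {N, J1 x N}) = 2 := by
  have h : LinearIndependent ℝ ![N, J1 x N] := by
    rw [LinearIndependent.pair_iff]
    intro s t hst
    have h1 := congrArg (gForm x N) hst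
    have h2 := congrArg (gForm x (J1 x N)) hst
    simp only [map_add, map_smul, map_zero, gForm_apply, hN, g_N_J1, g_comm x (J1 x N) N,
      g_J1_J1, smul_eq_mul] at h1 h2
    constructor <;> linarith
  have := finrank_span_eq_card h
  rwa [Matrix.range_cons, Matrix.range_cons, Matrix.range_empty, union_empty, ← insert_eq,
    Fintype.card_fin] at this

/-- N and J₁N are already independent, so dimension two forces PN into their span; as PN is
orthogonal to J₁N, it is then a multiple of N. Conversely PN = ±N gives JN = J₁PN = ±J₁N. -/
lemma finrank_span_eq_two_iff {x : CP3} {N : T x} (hN : g x N N = 1) :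
    finrank ℝ (Submodule.span ℝ {N, J x N, J1 x N, P x N}) = 2 ↔ P x N = N ∨ P x N = -N := by
  have hle : Submodule.span ℝ {N, J1 x N} ≤ Submodule.span ℝ {N, J x N, J1 x N, P x N} :=
    Submodule.span_mono (by intro v; simp; tauto)
  have h2 := finrank_span_pair_J1 hN
  constructor
  · intro h
    have heq := Submodule.eq_of_le_of_finrank_eq hle (h2.trans h.symm)
    have hP : P x N ∈ Submodule.span ℝ {N, J1 x N} := by
      rw [heq]
      exact Submodule.subset_span (by simp)
    obtain ⟨a, b, hab⟩ := Submodule.mem_span_pair.1 hP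
    have h3 := congrArg (gForm x (J1 x N)) hab
    simp only [map_add, map_smul, gForm_apply, hN, g_N_J1, g_comm x (J1 x N) N,
      g_comm x (J1 x N) (P x N), g_P_J1, g_J1_J1, smul_eq_mul] at h3
    have hb : b = 0 := by linarith
    refine P_eq_or_of_P_eq_smul (ne_zero_of_g_self hN) (a := a) ?_
    rw [← hab, hb, zero_smul, add_zero]
  · intro h
    have : Submodule.span ℝ {N, J x N, J1 x N, P x N} = Submodule.span ℝ {N, J1 x N} := by
      refine le_antisymm (Submodule.span_le.2 ?_) hle
      have m1 : N ∈ Submodule.span ℝ {N, J1 x N} := Submodule.subset_span (by simp)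
      have m2 : J1 x N ∈ Submodule.span ℝ {N, J1 x N} := Submodule.subset_span (by simp)
      rintro v (rfl | rfl | rfl | rfl)
      · exact m1
      · rw [J_apply, P_J1]
        rcases h with h | h <;> rw [h]
        · exact m2
        · rw [map_neg]
          exact Submodule.neg_mem _ m2
      · exact m2
      · rcases h with h | h <;> rw [h]
        · exact m1
        · exact Submodule.neg_mem _ m1
    rw [this, h2]

lemma g_N_J (x : CP3) (N : T x) : g x (J x N) N = 0 := by
  rw [J_apply, g_P_left, g_comm, g_P_J1]

lemma P_J (x : CP3) (X : T x) : P x (J x X) = J x (P x X) := by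
  rw [J_apply, J_apply, P_J1]

lemma J_J (x : CP3) (X : T x) : J x (J x X) = -X := by
  rw [J_apply, J_apply, ← P_J1, P_P, J1_J1]

instance instIsAddTorsionFreeT (x : CP3) : IsAddTorsionFree (T x) :=
  inferInstanceAs (IsAddTorsionFree C3)

/-- Since `D1` and `D2` together span the tangent space, they are the full eigenspaces of `P`. -/
lemma mem_D1_iff (x : CP3) (X : T x) : X ∈ D1 x ↔ P x X = -X := by
  refine ⟨P_of_mem_D1 x X, fun h => ?_⟩
  have hX : X ∈ D1 x ⊔ D2 x := by rw [D1_sup_D2]; trivial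
  obtain ⟨Y, hY, Z, hZ, rfl⟩ := Submodule.mem_sup.1 hX
  rw [map_add, P_of_mem_D1 x Y hY, P_of_mem_D2 x Z hZ, neg_add, add_right_inj, self_eq_neg] at h
  rwa [h, add_zero]

lemma mem_D2_iff (x : CP3) (X : T x) : X ∈ D2 x ↔ P x X = X := by
  refine ⟨P_of_mem_D2 x X, fun h => ?_⟩
  have hX : X ∈ D1 x ⊔ D2 x := by rw [D1_sup_D2]; trivial
  obtain ⟨Y, hY, Z, hZ, rfl⟩ := Submodule.mem_sup.1 hX
  rw [map_add, P_of_mem_D1 x Y hY, P_of_mem_D2 x Z hZ, add_left_inj, neg_eq_self] at h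
  rwa [h, zero_add]

lemma finrank_D2 (x : CP3) : finrank ℝ (D2 x) = 4 := by
  have h1 : D1 x ⊓ D2 x = ⊥ := by
    rw [eq_bot_iff]
    rintro X ⟨h1, h2⟩
    have h3 := P_of_mem_D1 x X h1
    rw [P_of_mem_D2 x X h2, self_eq_neg] at h3
    exact h3
  have h2 := Submodule.finrank_sup_add_finrank_inf_eq (D1 x) (D2 x)
  rw [D1_sup_D2, h1, finrank_top, finrank_T, finrank_D1, finrank_bot] at h2
  omega

/-! ### Unit normals -/

section Normal

variable {H : Type*} [TopologicalSpace H] [ChartedSpace (EuclideanSpace ℝ (Fin 5)) H]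
  {f : H → CP3}

instance instFiniteDimensionalTangentSpace (x : H) :
    FiniteDimensional ℝ (TangentSpace (𝓡 5) x) :=
  inferInstanceAs (FiniteDimensional ℝ (EuclideanSpace ℝ (Fin 5)))

lemma finrank_tangent (hf : IsHypersurface f) (x : H) : finrank ℝ (tangent f x) = 5 := by
  have h1 : finrank ℝ (tangent f x) = finrank ℝ (TangentSpace (𝓡 5) x) :=
    LinearMap.finrank_range_of_inj (hf.injective_mfderiv x)
  have h2 : finrank ℝ (TangentSpace (𝓡 5) x) = 5 := by
    change finrank ℝ (EuclideanSpace ℝ (Fin 5)) = 5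
    simp
  rw [h1, h2]

/-- Restricting g(N, ·) to the tangent space maps a space of dimension 6 to one of dimension 5. A
nonzero vector in the kernel can be normalized because g is positive definite. -/
lemma exists_isUnitNormal (hf : IsHypersurface f) (x : H) : ∃ N, IsUnitNormal f x N := by
  let L : T (f x) →ₗ[ℝ] (tangent f x →ₗ[ℝ] ℝ) :=
    (LinearMap.lcomp ℝ ℝ (tangent f x).subtype) ∘ₗ (gForm (f x))
  have hlt : finrank ℝ (tangent f x →ₗ[ℝ] ℝ) < finrank ℝ (T (f x)) := by
    rw [finrank_T, finrank_linearMap, finrank_tangent hf, finrank_self]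
    norm_num
  have hker := LinearMap.ker_ne_bot_of_finrank_lt (f := L) hlt
  obtain ⟨N, hN, hN0⟩ := Submodule.exists_mem_ne_zero_of_ne_bot hker
  have hpos := g_self_pos (f x) hN0
  refine ⟨(√(g (f x) N N))⁻¹ • N, ?_, ?_⟩
  · rw [← gForm_apply]
    simp only [map_smul, LinearMap.smul_apply, gForm_apply, smul_eq_mul]
    have := Real.mul_self_sqrt hpos.le
    have h0 := (Real.sqrt_pos.2 hpos).ne'
    field_simp
    rw [sq, this]
  · intro X hX
    have h1 : gForm (f x) N X = 0 := congrArg (fun l : tangent f x →ₗ[ℝ] ℝ => l ⟨X, hX⟩) hN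
    rw [gForm_apply, g_comm] at h1
    rw [← gForm_apply, map_smul, gForm_apply, h1, smul_zero]

lemma mem_tangent_iff (hf : IsHypersurface f) {x : H} {N : T (f x)} (hN : IsUnitNormal f x N)
    (X : T (f x)) : X ∈ tangent f x ↔ g (f x) X N = 0 := by
  have hle : tangent f x ≤ LinearMap.ker (gForm (f x) N) := fun Y hY => by
    rw [LinearMap.mem_ker, gForm_apply, g_comm]
    exact hN.2 Y hY
  have hr : LinearMap.range (gForm (f x) N) = ⊤ := by
    refine LinearMap.range_eq_top.2 (LinearMap.surjective ?_)
    intro h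
    have h1 : gForm (f x) N N = 0 := by rw [h]; rfl
    rw [gForm_apply, hN.1] at h1
    exact one_ne_zero h1
  have h1 := (gForm (f x) N).finrank_range_add_finrank_ker
  rw [hr, finrank_top, finrank_self, finrank_T] at h1
  have h2 := Submodule.eq_of_le_of_finrank_eq hle (by rw [finrank_tangent hf]; omega)
  rw [h2, LinearMap.mem_ker, gForm_apply, g_comm]

/-- The vector PN - N always lies in `D1`; if it is tangent, pairing it with N gives g(N, PN) = 1.
Conversely, eigenvectors of the self-adjoint `P` for different eigenvalues are orthogonal. -/
lemma D1_le_tangent_iff (hf : IsHypersurface f) {x : H} {N : T (f x)} (hN : IsUnitNormal f x N) :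
    D1 (f x) ≤ tangent f x ↔ P (f x) N = N := by
  constructor
  · intro h
    have h1 : P (f x) N - N ∈ D1 (f x) := by
      rw [mem_D1_iff, map_sub, P_P, neg_sub]
    have h2 := (mem_tangent_iff hf hN _).1 (h h1)
    refine P_eq_self_of_one_le hN.1 ?_
    rw [← gForm_apply, map_sub, LinearMap.sub_apply, gForm_apply, gForm_apply, hN.1,
      g_comm] at h2
    linarith
  · intro h X hX
    rw [mem_tangent_iff hf hN]
    have h1 := g_P_left (f x) X N
    rw [P_of_mem_D1 _ X hX, h, ← gForm_apply, ← gForm_apply, map_neg, LinearMap.neg_apply] at h1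
    rw [← gForm_apply]
    linarith

/-- Here PN + N lies in `D2`, and its squared length is 2 g(PN + N, N), which vanishes when it is
tangent. -/
lemma D2_le_tangent_iff (hf : IsHypersurface f) {x : H} {N : T (f x)} (hN : IsUnitNormal f x N) :
    D2 (f x) ≤ tangent f x ↔ P (f x) N = -N := by
  constructor
  · intro h
    have h1 : P (f x) N + N ∈ D2 (f x) := by
      rw [mem_D2_iff, map_add, P_P, add_comm]
    have h2 := (mem_tangent_iff hf hN _).1 (h h1)
    have h3 : g (f x) (P (f x) N + N) (P (f x) N + N) = 0 := by
      have e1 := g_P_P (f x) N N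
      have e2 := g_comm (f x) (P (f x) N) N
      have e3 := hN.1
      simp only [← gForm_apply, map_add, LinearMap.add_apply] at *
      linarith
    exact eq_neg_of_add_eq_zero_left (eq_zero_of_g_self h3)
  · intro h X hX
    rw [mem_tangent_iff hf hN]
    have h1 := g_P_left (f x) X N
    rw [P_of_mem_D2 _ X hX, h, ← gForm_apply, ← gForm_apply, map_neg] at h1
    rw [← gForm_apply]
    linarith

lemma isHorizontal_iff (hf : IsHypersurface f) :
    IsHorizontal f ↔ ∀ x, D1 (f x) ≤ tangent f x := by
  constructor
  · intro h x
    obtain ⟨N, hN⟩ := exists_isUnitNormal hf x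
    rw [D1_le_tangent_iff hf hN, ← angle_eq_zero_iff hN.1]
    exact h x N hN
  · intro h x N hN
    rw [angle_eq_zero_iff hN.1, ← D1_le_tangent_iff hf hN]
    exact h x

/-- At each point, the tangent space contains one of the two distributions. -/
def ContainsDistribution (f : H → CP3) : Prop :=
  ∀ x, D1 (f x) ≤ tangent f x ∨ D2 (f x) ≤ tangent f x

lemma containsDistribution_iff (hf : IsHypersurface f) : ContainsDistribution f ↔
    ∀ (x : H) (N : T (f x)), IsUnitNormal f x N → P (f x) N = N ∨ P (f x) N = -N := by
  constructor
  · intro h x N hN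
    rw [← D1_le_tangent_iff hf hN, ← D2_le_tangent_iff hf hN]
    exact h x
  · intro h x
    obtain ⟨N, hN⟩ := exists_isUnitNormal hf x
    rw [D1_le_tangent_iff hf hN, D2_le_tangent_iff hf hN]
    exact h x N hN

lemma hasTwoDimSpan_iff (hf : IsHypersurface f) : HasTwoDimSpan f ↔ ContainsDistribution f := by
  rw [containsDistribution_iff hf]
  exact forall_congr' fun x => forall_congr' fun N => forall_congr' fun hN =>
    finrank_span_eq_two_iff hN.1

lemma isPInvariant_iff (hf : IsHypersurface f) : IsPInvariant f ↔ ContainsDistribution f := by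
  rw [containsDistribution_iff hf]
  refine forall_congr' fun x => forall_congr' fun N => forall_congr' fun hN => ?_
  constructor
  · intro h
    -- The test vector is PN - cN, the tangential part of PN; it is orthogonal to JN = PJ₁N because
    -- `P` is an isometry. Its image N - cPN is tangent only if c² = 1, and 1 - c² is the squared
    -- length of PN - cN.
    set c := g (f x) (P (f x) N) N with hc
    have h1 : P (f x) N - c • N ∈ tangent f x := by
      rw [mem_tangent_iff hf hN, ← gForm_apply, map_sub, map_smul, LinearMap.sub_apply,
        LinearMap.smul_apply, gForm_apply, gForm_apply, hN.1]
      simp [hc]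
    have h2 : g (f x) (P (f x) N - c • N) (J (f x) N) = 0 := by
      rw [← gForm_apply, map_sub, map_smul, LinearMap.sub_apply,
        LinearMap.smul_apply, gForm_apply, gForm_apply, g_comm _ N, g_N_J, J_apply, g_P_P, g_N_J1]
      simp
    have h3 := (mem_tangent_iff hf hN _).1 (h _ h1 h2).1
    rw [map_sub, P_P, map_smul, ← gForm_apply, map_sub, map_smul, LinearMap.sub_apply,
      LinearMap.smul_apply, gForm_apply, gForm_apply, hN.1, ← hc, smul_eq_mul] at h3
    refine P_eq_or_of_P_eq_smul (ne_zero_of_g_self hN.1) (a := c) ?_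
    rw [← sub_eq_zero]
    apply eq_zero_of_g_self
    have e1 := g_P_P (f x) N N
    have e2 := g_comm (f x) (P (f x) N) N
    have e3 := hN.1
    rw [← hc] at e2
    simp only [← gForm_apply, map_sub, map_smul, LinearMap.sub_apply, LinearMap.smul_apply,
      smul_eq_mul] at *
    rw [e1, e3, ← e2, ← hc]
    linarith
  · intro h X hX hXJ
    have hX' := (mem_tangent_iff hf hN X).1 hX
    rw [mem_tangent_iff hf hN, g_P_left, g_P_left, P_J]
    rcases h with h | h <;> rw [h]
    · exact ⟨hX', hXJ⟩
    · rw [map_neg, ← gForm_apply, ← gForm_apply, map_neg, map_neg, gForm_apply, gForm_apply, hX',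
        hXJ, neg_zero]
      exact ⟨rfl, rfl⟩

/-- JN is always tangent, so the distribution is the whole line through JN. As `P` commutes with `J`
and J² = -1, the vector JN is an eigenvector of `P` exactly when N is. -/
lemma isPInvariantLine_iff (hf : IsHypersurface f) :
    IsPInvariantLine f ↔ ContainsDistribution f := by
  rw [containsDistribution_iff hf]
  refine forall_congr' fun x => forall_congr' fun N => forall_congr' fun hN => ?_
  have hJ : J (f x) N ∈ tangent f x := by
    rw [mem_tangent_iff hf hN, g_N_J]
  constructor
  · intro h
    obtain ⟨a, ha⟩ := Submodule.mem_span_singleton.1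
      (h _ ⟨Submodule.mem_span_singleton_self _, hJ⟩).1
    refine P_eq_or_of_P_eq_smul (ne_zero_of_g_self hN.1) (a := a) ?_
    have h1 := congrArg (J (f x)) ha
    rw [P_J, J_J, map_smul, J_J, smul_neg, neg_inj] at h1
    exact h1.symm
  · rintro h X ⟨hX, -⟩
    obtain ⟨c, rfl⟩ := Submodule.mem_span_singleton.1 hX
    have h1 : J (f x) N ∈ Submodule.span ℝ {J (f x) N} ⊓ tangent f x :=
      ⟨Submodule.mem_span_singleton_self _, hJ⟩
    rw [map_smul, P_J]
    apply Submodule.smul_mem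
    rcases h with h | h <;> rw [h]
    · exact h1
    · rw [map_neg]
      exact Submodule.neg_mem _ h1

end Normal

/-! ### Smooth maps in charts -/

section Charts

variable {E F : Type*} [NormedAddCommGroup E] [NormedSpace ℝ E]
  [NormedAddCommGroup F] [NormedSpace ℝ F]
  {HM HN : Type*} [TopologicalSpace HM] [TopologicalSpace HN]
  {I : ModelWithCorners ℝ E HM} {IN : ModelWithCorners ℝ F HN}
  {M N : Type*} [TopologicalSpace M] [ChartedSpace HM M]
  [TopologicalSpace N] [ChartedSpace HN N]

variable (I IN) in
/-- The expression of a map in the preferred charts at `x₀` and `y₀`. -/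
noncomputable def chartRep (x₀ : M) (y₀ : N) (f : M → N) : E → F :=
  extChartAt IN y₀ ∘ f ∘ (extChartAt I x₀).symm

variable (I IN) in
/-- The natural domain of `chartRep`. -/
def chartRepDomain (x₀ : M) (y₀ : N) (f : M → N) : Set E :=
  (extChartAt I x₀).target ∩ (extChartAt I x₀).symm ⁻¹' (f ⁻¹' (extChartAt IN y₀).source)

lemma isOpen_chartRepDomain [I.Boundaryless] (x₀ : M) (y₀ : N) {f : M → N} (hf : Continuous f) :
    IsOpen (chartRepDomain I IN x₀ y₀ f) :=
  (continuousOn_extChartAt_symm x₀).isOpen_inter_preimage (isOpen_extChartAt_target x₀)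
    ((isOpen_extChartAt_source y₀).preimage hf)

lemma mem_chartRepDomain {x₀ x : M} {y₀ : N} {f : M → N} (hx : x ∈ (extChartAt I x₀).source)
    (hy : f x ∈ (extChartAt IN y₀).source) :
    extChartAt I x₀ x ∈ chartRepDomain I IN x₀ y₀ f := by
  refine ⟨(extChartAt I x₀).map_source hx, ?_⟩
  rwa [mem_preimage, (extChartAt I x₀).left_inv hx]

lemma chartRep_extChartAt {x₀ x : M} {y₀ : N} {f : M → N} (hx : x ∈ (extChartAt I x₀).source) :
    chartRep I IN x₀ y₀ f (extChartAt I x₀ x) = extChartAt IN y₀ (f x) := by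
  rw [chartRep, comp_apply, comp_apply, (extChartAt I x₀).left_inv hx]

variable [IsManifold I ∞ M] [IsManifold IN ∞ N]

lemma contDiffOn_chartRep (x₀ : M) (y₀ : N) {f : M → N} (hf : ContMDiff I IN ∞ f) :
    ContDiffOn ℝ ∞ (chartRep I IN x₀ y₀ f) (chartRepDomain I IN x₀ y₀ f) := by
  rw [← contMDiffOn_iff_contDiffOn]
  refine (contMDiffOn_extChartAt (I := IN) (x := y₀)).comp (hf.comp_contMDiffOn
    ((contMDiffOn_extChartAt_symm x₀).mono inter_subset_left)) ?_
  intro u hu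
  simpa using hu.2

lemma mdifferentiableAt_extChartAt_of_mem {x₀ x : M} (hx : x ∈ (extChartAt I x₀).source) :
    MDifferentiableAt I 𝓘(ℝ, E) (extChartAt I x₀) x := by
  have : IsManifold I 1 M := IsManifold.of_le (n := ∞) (by simp)
  exact mdifferentiableAt_extChartAt (by simpa using hx)

lemma bijective_mfderiv_extChartAt {x₀ x : M} (hx : x ∈ (extChartAt I x₀).source) :
    Bijective (mfderiv I 𝓘(ℝ, E) (extChartAt I x₀) x) := by
  have : IsManifold I 1 M := IsManifold.of_le (n := ∞) (by simp)
  obtain ⟨e, he⟩ := isInvertible_mfderiv_extChartAt (I := I) hx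
  rw [← he]
  exact e.bijective

variable [I.Boundaryless]

/-- The chain rule at an arbitrary point of the chart domains, not only at their centres. It
transfers facts about `mfderiv` to a whole open set of a normed space. -/
lemma fderiv_chartRep_apply {x₀ x : M} {y₀ : N} {f : M → N} (hf : ContMDiff I IN ∞ f)
    (hx : x ∈ (extChartAt I x₀).source) (hy : f x ∈ (extChartAt IN y₀).source)
    (v : TangentSpace I x) :
    fderiv ℝ (chartRep I IN x₀ y₀ f) (extChartAt I x₀ x)
        (mfderiv I 𝓘(ℝ, E) (extChartAt I x₀) x v) =
      mfderiv IN 𝓘(ℝ, F) (extChartAt IN y₀) (f x) (mfderiv I IN f x v) := by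
  have h1 := HasMFDerivAt.comp x (mdifferentiableAt_extChartAt_of_mem hy).hasMFDerivAt
    ((hf x).mdifferentiableAt (by simp)).hasMFDerivAt
  have h2 : HasFDerivAt (chartRep I IN x₀ y₀ f) _ (extChartAt I x₀ x) :=
    (((contDiffOn_chartRep x₀ y₀ hf).contDiffAt ((isOpen_chartRepDomain x₀ y₀
      hf.continuous).mem_nhds (mem_chartRepDomain hx hy))).differentiableAt
      (by simp)).hasFDerivAt
  have h3 := HasMFDerivAt.comp x h2.hasMFDerivAt
    (mdifferentiableAt_extChartAt_of_mem hx).hasMFDerivAt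
  have h4 : extChartAt IN y₀ ∘ f =ᶠ[𝓝 x] chartRep I IN x₀ y₀ f ∘ extChartAt I x₀ := by
    filter_upwards [(isOpen_extChartAt_source (I := I) x₀).mem_nhds hx] with z hz
    exact (chartRep_extChartAt hz).symm
  have h5 := hasMFDerivAt_unique h1 (h3.congr_of_eventuallyEq h4)
  exact (congrArg (fun L : E →L[ℝ] F => L v) h5).symm

lemma surjective_fderiv_chartRep_iff {x₀ x : M} {y₀ : N} {f : M → N} (hf : ContMDiff I IN ∞ f)
    (hx : x ∈ (extChartAt I x₀).source) (hy : f x ∈ (extChartAt IN y₀).source) :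
    Surjective (fderiv ℝ (chartRep I IN x₀ y₀ f) (extChartAt I x₀ x)) ↔
      Surjective (mfderiv I IN f x) := by
  have hA := bijective_mfderiv_extChartAt hx
  have hB := bijective_mfderiv_extChartAt hy
  have h := funext (fderiv_chartRep_apply hf hx hy)
  constructor
  · intro hs
    have h1 := hs.comp hA.2
    intro w
    obtain ⟨v, hv⟩ := h1 (mfderiv IN 𝓘(ℝ, F) (extChartAt IN y₀) (f x) w)
    exact ⟨v, hB.1 ((congrFun h v).symm.trans hv)⟩
  · intro hs w
    obtain ⟨w', rfl⟩ := hB.2 w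
    obtain ⟨v, rfl⟩ := hs w'
    exact ⟨_, congrFun h v⟩

/-- For a right inverse R of L, the operator L'R is close to the identity when L' is close to L,
hence invertible. -/
lemma eventually_surjective [FiniteDimensional ℝ F] {L : E →L[ℝ] F} (hL : Surjective L) :
    ∀ᶠ L' in 𝓝 L, Surjective (L' : E →L[ℝ] F) := by
  have : CompleteSpace F := FiniteDimensional.complete ℝ F
  obtain ⟨R, hR⟩ := (L : E →ₗ[ℝ] F).exists_rightInverse_of_surjective (LinearMap.range_eq_top.2 hL)
  have hR' : L.comp (LinearMap.toContinuousLinearMap R) =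
      ((ContinuousLinearEquiv.refl ℝ F : F ≃L[ℝ] F) : F →L[ℝ] F) := by
    ext v
    exact congrArg (fun S : F →ₗ[ℝ] F => S v) hR
  have hcont : Continuous fun L' : E →L[ℝ] F => L'.comp (LinearMap.toContinuousLinearMap R) := by
    fun_prop
  have h1 := hcont.continuousAt (x := L)
  have h2 := ContinuousLinearEquiv.nhds (ContinuousLinearEquiv.refl ℝ F : F ≃L[ℝ] F)
  rw [← hR'] at h2
  filter_upwards [h1 h2] with L' hL'
  obtain ⟨e, he⟩ := hL'
  intro w
  refine ⟨R (e.symm w), ?_⟩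
  have h3 := congrArg (fun S : F →L[ℝ] F => S (e.symm w)) he
  simpa using h3.symm

/-- The points where a smooth map is a submersion form an open set. -/
lemma isOpen_setOf_surjective_mfderiv [FiniteDimensional ℝ F] {f : M → N}
    (hf : ContMDiff I IN ∞ f) :
    IsOpen {x | Surjective (mfderiv I IN f x)} := by
  rw [isOpen_iff_mem_nhds]
  intro x hx
  have hxs := mem_extChartAt_source (I := I) x
  have hys := mem_extChartAt_source (I := IN) (f x)
  have hO := isOpen_chartRepDomain (I := I) (IN := IN) x (f x) hf.continuous
  have hc : ContinuousAt (fderiv ℝ (chartRep I IN x (f x) f)) (extChartAt I x x) :=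
    ((contDiffOn_chartRep x (f x) hf).continuousOn_fderiv_of_isOpen hO (by simp)).continuousAt
      (hO.mem_nhds (mem_chartRepDomain hxs hys))
  have h1 := hc.eventually
    (eventually_surjective ((surjective_fderiv_chartRep_iff hf hxs hys).2 hx))
  have h2 := (continuousAt_extChartAt (I := I) x).eventually h1
  filter_upwards [h2, (isOpen_extChartAt_source (I := I) x).mem_nhds hxs,
    ((isOpen_extChartAt_source (I := IN) (f x)).preimage hf.continuous).mem_nhds hys]
    with z hz hz1 hz2
  exact (surjective_fderiv_chartRep_iff hf hz1 hz2).1 hz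

/-- Submersions are open maps. -/
lemma isOpenMap_of_surjective_mfderiv [FiniteDimensional ℝ E] [FiniteDimensional ℝ F]
    [IN.Boundaryless] {f : M → N} (hf : ContMDiff I IN ∞ f)
    (hs : ∀ x, Surjective (mfderiv I IN f x)) : IsOpenMap f := by
  have : CompleteSpace E := FiniteDimensional.complete ℝ E
  have : CompleteSpace F := FiniteDimensional.complete ℝ F
  rw [isOpenMap_iff_nhds_le]
  intro x
  have hxs := mem_extChartAt_source (I := I) x
  have hys := mem_extChartAt_source (I := IN) (f x)
  have hO := isOpen_chartRepDomain (I := I) (IN := IN) x (f x) hf.continuous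
  have hd : HasStrictFDerivAt (chartRep I IN x (f x) f)
      (fderiv ℝ (chartRep I IN x (f x) f) (extChartAt I x x)) (extChartAt I x x) :=
    ((contDiffOn_chartRep x (f x) hf).contDiffAt
      (hO.mem_nhds (mem_chartRepDomain hxs hys))).hasStrictFDerivAt (by simp)
  have h1 := hd.map_nhds_eq_of_surj
    (LinearMap.range_eq_top.2 ((surjective_fderiv_chartRep_iff hf hxs hys).2 (hs x)))
  rw [chartRep_extChartAt hxs, ← map_extChartAt_nhds_of_boundaryless (I := I) x,
    Filter.map_map] at h1
  have h2 : chartRep I IN x (f x) f ∘ extChartAt I x =ᶠ[𝓝 x] extChartAt IN (f x) ∘ f := by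
    filter_upwards [(isOpen_extChartAt_source (I := I) x).mem_nhds hxs] with z hz
    exact chartRep_extChartAt hz
  rw [Filter.map_congr h2, ← map_extChartAt_nhds_of_boundaryless (I := IN) (f x)] at h1
  have h3 := congrArg (Filter.map (extChartAt IN (f x)).symm) h1
  rw [Filter.map_map, Filter.map_map] at h3
  have h4 : (extChartAt IN (f x)).symm ∘ extChartAt IN (f x) =ᶠ[𝓝 (f x)] id := by
    filter_upwards [(isOpen_extChartAt_source (I := IN) (f x)).mem_nhds hys] with z hz
    exact (extChartAt IN (f x)).left_inv hz
  have h5 : (extChartAt IN (f x)).symm ∘ extChartAt IN (f x) ∘ f =ᶠ[𝓝 x] f := by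
    filter_upwards [hf.continuous.continuousAt.eventually h4] with z hz
    exact hz
  rw [Filter.map_congr h4, Filter.map_congr h5, Filter.map_id] at h3
  exact h3.ge

end Charts

lemma isOpenMap_tau : IsOpenMap tau :=
  isOpenMap_of_surjective_mfderiv contMDiff_tau surjective_mfderiv_tau

/-! ### Horizontal hypersurfaces and preimages -/

section Preimage

variable {H : Type*} [TopologicalSpace H] [ChartedSpace (EuclideanSpace ℝ (Fin 5)) H]
  {f : H → CP3}

/-- A hypersurface tangent to the fibres of the twistor fibration is locally a preimage. -/
lemma isLocallyPreimage_of_D1_le [IsManifold (𝓡 5) ∞ H] (hf : IsHypersurface f)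
    (h : ∀ x, D1 (f x) ≤ tangent f x) : IsLocallyPreimage f := by
  intro x
  set e := extChartAt (𝓡 5) x
  set c := extChartAt 𝓘(ℝ, C3) (f x)
  set d := extChartAt (𝓡 4) (tau (f x)) with hd
  have hxs : x ∈ e.source := mem_extChartAt_source x
  have hys : f x ∈ c.source := mem_extChartAt_source (f x)
  have hzs : tau (f x) ∈ d.source := mem_extChartAt_source (tau (f x))
  set f' := chartRep (𝓡 5) 𝓘(ℝ, C3) x (f x) f
  set τ' := chartRep 𝓘(ℝ, C3) (𝓡 4) (f x) (tau (f x)) tau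
  set Ω' := chartRepDomain 𝓘(ℝ, C3) (𝓡 4) (f x) (tau (f x)) tau
  have hΩ'o : IsOpen Ω' := isOpen_chartRepDomain _ _ contMDiff_tau.continuous
  have hf's := contDiffOn_chartRep x (f x) hf.contMDiff
  set Ω := chartRepDomain (𝓡 5) 𝓘(ℝ, C3) x (f x) f ∩ f' ⁻¹' Ω'
  have hΩo : IsOpen Ω := hf's.continuousOn.isOpen_inter_preimage
    (isOpen_chartRepDomain _ _ hf.contMDiff.continuous) hΩ'o
  have hpt : ∀ u ∈ Ω, ∃ z ∈ e.source, f z ∈ c.source ∧ tau (f z) ∈ d.source ∧ u = e z := by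
    intro u hu
    have hr : e (e.symm u) = u := e.right_inv hu.1.1
    refine ⟨e.symm u, e.map_target hu.1.1, hu.1.2, ?_, hr.symm⟩
    have h1 : f' u ∈ Ω' := hu.2
    have h2 : f' u = c (f (e.symm u)) := rfl
    have h3 := h1.2
    rw [h2, mem_preimage] at h3
    have h4 : c.symm (c (f (e.symm u))) = f (e.symm u) := c.left_inv hu.1.2
    rw [h4] at h3
    exact h3
  have hxΩ : e x ∈ Ω := by
    refine ⟨mem_chartRepDomain hxs hys, ?_⟩
    change f' (e x) ∈ Ω'
    have h1 : f' (e x) = c (f x) := chartRep_extChartAt hxs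
    rw [h1]
    exact mem_chartRepDomain hys hzs
  -- The normal form is applied to the chart expressions of `f` and `tau`; its hypothesis on kernels
  -- is the inclusion of `D1` in the tangent spaces, since `D1` is the kernel of dτ.
  obtain ⟨U, hUΩ, hUo, hxU, V, hVΩ, hVo, W, φ, hWo, hφ, hφ', himage⟩ :=
    exists_image_eq_preimage_levelSet (f := f') (τ := τ') hΩo hΩ'o hxΩ (fun u hu => hu.2)
      (hf's.mono inter_subset_left) (contDiffOn_chartRep _ _ contMDiff_tau)
      (by
        have := finrank_T (f x)
        change finrank ℝ C3 = 6 at this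
        simp [this])
      (by
        have hA := bijective_mfderiv_extChartAt hxs
        have hB := bijective_mfderiv_extChartAt hys
        have hin := hB.1.comp (hf.injective_mfderiv x)
        intro v w hvw
        obtain ⟨v, rfl⟩ := hA.2 v
        obtain ⟨w, rfl⟩ := hA.2 w
        have e1 := fderiv_chartRep_apply hf.contMDiff hxs hys v
        have e2 := fderiv_chartRep_apply hf.contMDiff hxs hys w
        have e3 : v = w := hin (e1.symm.trans (hvw.trans e2))
        rw [e3])
      (by
        have h1 : f' (e x) = c (f x) := chartRep_extChartAt hxs
        rw [h1]
        exact (surjective_fderiv_chartRep_iff contMDiff_tau hys hzs).2 (surjective_mfderiv_tau _))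
      (by
        intro u hu w hw
        obtain ⟨z, hz1, hz2, hz3, rfl⟩ := hpt u hu
        have h1 : f' (e z) = c (f z) := chartRep_extChartAt hz1
        rw [h1] at hw
        obtain ⟨w, rfl⟩ := (bijective_mfderiv_extChartAt hz2).2 w
        have h2 := fderiv_chartRep_apply contMDiff_tau hz2 hz3 w
        have h3 := h2.symm.trans hw
        have h4 := (bijective_mfderiv_extChartAt hz3).1 (h3.trans (map_zero _).symm)
        obtain ⟨v, hv⟩ := h z ((mfderiv_tau_eq_zero_iff _ _).1 h4)
        refine ⟨mfderiv (𝓡 5) 𝓘(ℝ, EuclideanSpace ℝ (Fin 5)) e z v, ?_⟩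
        exact (fderiv_chartRep_apply hf.contMDiff hz1 hz2 v).trans (congrArg _ hv))
  refine ⟨e.source ∩ e ⁻¹' U, isOpen_extChartAt_preimage' x hUo, ⟨hxs, hxU⟩,
    c.source ∩ c ⁻¹' V, isOpen_extChartAt_preimage' (f x) hVo,
    d.source ∩ d ⁻¹' {z ∈ W | φ z = 0}, ?_, ?_⟩
  · rintro y ⟨hy1, hy2⟩
    refine ⟨d.source ∩ d ⁻¹' W, isOpen_extChartAt_preimage' (tau (f x)) hWo, ⟨hy1, hy2.1⟩, φ ∘ d,
      ?_, ?_, ?_⟩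
    · refine (contMDiffOn_iff_contDiffOn.2 hφ).comp
        ((contMDiffOn_extChartAt (I := 𝓡 4) (x := tau (f x))).mono ?_) inter_subset_right
      intro z hz
      simpa [hd] using hz.1
    · rintro z ⟨hz1, hz2⟩ h0
      apply hφ' _ hz2
      have h1 : HasFDerivAt φ (fderiv ℝ φ (d z)) (d z) :=
        ((hφ.contDiffAt (hWo.mem_nhds hz2)).differentiableAt (by simp)).hasFDerivAt
      have h2 := HasMFDerivAt.comp z h1.hasMFDerivAt
        (mdifferentiableAt_extChartAt_of_mem hz1).hasMFDerivAt
      rw [h2.mfderiv] at h0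
      ext w
      obtain ⟨w, rfl⟩ := (bijective_mfderiv_extChartAt hz1).2 w
      exact congrArg (fun L : EuclideanSpace ℝ (Fin 4) →L[ℝ] ℝ => L w) h0
    · ext z
      simp only [mem_inter_iff, mem_preimage, mem_ofPred_eq, comp_apply]
      tauto
  · ext y
    constructor
    · rintro ⟨z, ⟨hz1, hz2⟩, rfl⟩
      obtain ⟨z', hz'1, hz'2, hz'3, hz'⟩ := hpt _ (hUΩ hz2)
      obtain rfl : z = z' := e.injOn hz1 hz'1 hz'
      have h1 : f' (e z) ∈ f' '' U := mem_image_of_mem _ hz2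
      have h2 : f' (e z) = c (f z) := chartRep_extChartAt hz1
      have h3 : τ' (c (f z)) = d (tau (f z)) := chartRep_extChartAt hz'2
      rw [himage, h2, mem_inter_iff, mem_preimage, h3] at h1
      exact ⟨⟨hz'2, h1.1⟩, hz'3, h1.2⟩
    · rintro ⟨⟨hy1, hy2⟩, hy3, hy4⟩
      have h3 : τ' (c y) = d (tau y) := chartRep_extChartAt hy1
      have h1 : c y ∈ f' '' U := by
        rw [himage]
        refine ⟨hy2, ?_⟩
        rw [mem_preimage, h3]
        exact hy4
      obtain ⟨u, hu, hu'⟩ := h1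
      obtain ⟨z, hz1, hz2, -, rfl⟩ := hpt u (hUΩ hu)
      have h2 : f' (e z) = c (f z) := chartRep_extChartAt hz1
      exact ⟨z, ⟨hz1, hu⟩, c.injOn hz2 hy1 (h2.symm.trans hu')⟩

/-- A hypersurface whose image lies locally in a preimage is tangent to the fibres. -/
lemma D1_le_tangent_of_subset_preimage (hf : IsHypersurface f) {x : H} {U : Set H} (hU : IsOpen U)
    (hx : x ∈ U) {M : Set S4} (hM : IsHypersurfaceS4 M) (h : f '' U ⊆ tau ⁻¹' M) :
    D1 (f x) ≤ tangent f x := by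
  obtain ⟨O, hO, hxO, φ, hφ, hφ', hMO⟩ := hM (tau (f x)) (h (mem_image_of_mem f hx))
  have hcont : Continuous (tau ∘ f) := contMDiff_tau.continuous.comp hf.contMDiff.continuous
  have hφd : HasMFDerivAt (𝓡 4) 𝓘(ℝ, ℝ) φ (tau (f x)) (mfderiv (𝓡 4) 𝓘(ℝ, ℝ) φ (tau (f x))) :=
    ((hφ.contMDiffAt (hO.mem_nhds hxO)).mdifferentiableAt (by simp)).hasMFDerivAt
  have hfd : HasMFDerivAt (𝓡 5) 𝓘(ℝ, C3) f x (mfderiv (𝓡 5) 𝓘(ℝ, C3) f x) :=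
    ((hf.contMDiff x).mdifferentiableAt (by simp)).hasMFDerivAt
  have h1 := HasMFDerivAt.comp x hφd (HasMFDerivAt.comp x (hasMFDerivAt_tau (f x)) hfd)
  -- The composite φ ∘ τ ∘ f vanishes near x, so the tangent space lies in the kernel of dφ ∘ dτ.
  have h2 : (fun _ : H => (0 : ℝ)) =ᶠ[𝓝 x] φ ∘ tau ∘ f := by
    filter_upwards [hU.mem_nhds hx, (hO.preimage hcont).mem_nhds hxO] with z hz hz'
    have h3 : tau (f z) ∈ M ∩ O := ⟨h (mem_image_of_mem f hz), hz'⟩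
    rw [hMO] at h3
    exact h3.2.symm
  have h3 := hasMFDerivAt_unique (hasMFDerivAt_const (I := 𝓡 5) (I' := 𝓘(ℝ, ℝ)) (0 : ℝ) x)
    (h1.congr_of_eventuallyEq h2)
  let L : T (f x) →ₗ[ℝ] ℝ := (mfderiv (𝓡 4) 𝓘(ℝ, ℝ) φ (tau (f x))).toLinearMap ∘ₗ
    (mfderiv 𝓘(ℝ, C3) (𝓡 4) tau (f x)).toLinearMap
  have hle : tangent f x ≤ LinearMap.ker L := by
    rintro _ ⟨v, rfl⟩
    exact (congrArg (fun S : EuclideanSpace ℝ (Fin 5) →L[ℝ] ℝ => S v) h3).symm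
  have hL : L ≠ 0 := by
    intro h0
    apply hφ' _ hxO
    ext w
    obtain ⟨w, rfl⟩ := surjective_mfderiv_tau (f x) w
    exact congrArg (fun S : T (f x) →ₗ[ℝ] ℝ => S w) h0
  have h4 := L.finrank_range_add_finrank_ker
  rw [LinearMap.range_eq_top.2 (LinearMap.surjective hL), finrank_top, finrank_self,
    finrank_T] at h4
  -- Both spaces have dimension 5, so the tangent space is the entire kernel, and this contains ker
  -- dτ.
  have h5 := Submodule.eq_of_le_of_finrank_eq hle (by rw [finrank_tangent hf]; omega)
  intro X hX
  rw [h5, LinearMap.mem_ker]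
  have h6 := (mfderiv_tau_eq_zero_iff (f x) X).2 hX
  change mfderiv (𝓡 4) 𝓘(ℝ, ℝ) φ (tau (f x)) (mfderiv 𝓘(ℝ, C3) (𝓡 4) tau (f x) X) = 0
  rw [h6, map_zero]

end Preimage

/-! ### From local to global preimages -/

lemma isPreimage_of_isLocallyPreimage {H : Type*} [TopologicalSpace H] {f : H → CP3}
    (hf : IsLocallyPreimage f) (hemb : Topology.IsEmbedding f)
    (hclosed : ∀ y : S4, IsClosed (range f ∩ tau ⁻¹' {y})) : IsPreimage f := by
  have hfull : range f = tau ⁻¹' (tau '' range f) := by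
    refine Subset.antisymm (subset_preimage_image _ _) ?_
    rintro z ⟨_, ⟨x, rfl⟩, hxz⟩
    -- The image meets the fibre in a relatively open set: near f(a) it contains V ∩ τ⁻¹(M), and
    -- with f(a) this contains every point of V in the same fibre.
    have hopen : ∃ G : Set CP3, IsOpen G ∧
        range f ∩ tau ⁻¹' {tau z} = G ∩ tau ⁻¹' {tau z} := by
      refine ⟨⋃₀ {G | IsOpen G ∧ G ∩ tau ⁻¹' {tau z} ⊆ range f}, isOpen_sUnion fun G hG => hG.1,
        ?_⟩
      ext w
      constructor
      · rintro ⟨⟨a, rfl⟩, hw⟩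
        obtain ⟨U, -, haU, V, hV, M, -, hUV⟩ := hf a
        have h1 : f a ∈ V ∩ tau ⁻¹' M := by
          rw [← hUV]
          exact mem_image_of_mem f haU
        refine ⟨⟨V, ⟨hV, ?_⟩, h1.1⟩, hw⟩
        rintro b ⟨hb1, hb2⟩
        have h2 : b ∈ f '' U := by
          rw [hUV]
          refine ⟨hb1, ?_⟩
          have h3 : tau b = tau (f a) := Eq.trans hb2 (Eq.symm hw)
          rw [mem_preimage, h3]
          exact h1.2
        exact image_subset_range f U h2
      · rintro ⟨⟨G, hG, hwG⟩, hw⟩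
        exact ⟨hG.2 ⟨hwG, hw⟩, hw⟩
    obtain ⟨G, hGo, hG⟩ := hopen
    by_contra hz
    have hpre := isPreconnected_preimage_tau (tau z)
    -- A point of the fibre outside the image would split the connected fibre into two nonempty
    -- relatively open parts.
    obtain ⟨w, hw, hw1, hw2⟩ := hpre G (range f ∩ tau ⁻¹' {tau z})ᶜ hGo
      (hclosed (tau z)).isOpen_compl
      (by
        intro w hw
        by_cases hwG : w ∈ G
        · exact Or.inl hwG
        · right
          rw [hG]
          exact fun h => hwG h.1)
      (by
        have : f x ∈ range f ∩ tau ⁻¹' {tau z} := ⟨mem_range_self x, hxz⟩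
        rw [hG] at this
        exact ⟨f x, this.2, this.1⟩)
      ⟨z, rfl, fun h => hz h.1⟩
    exact hw2 (by rw [hG]; exact ⟨hw1, hw⟩)
  refine ⟨tau '' range f, ?_, hfull⟩
  rintro _ ⟨_, ⟨x, rfl⟩, rfl⟩
  obtain ⟨U, hU, hxU, V, hV, M, hM, hUV⟩ := hf x
  -- The embedding hypothesis enters here: inside V' the image consists of f(U) alone, so no other
  -- sheet of the hypersurface comes near f(x).
  obtain ⟨V', hV', rfl⟩ := hemb.isOpen_iff.1 hU
  have hx : f x ∈ V ∩ tau ⁻¹' M := by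
    rw [← hUV]
    exact mem_image_of_mem f hxU
  obtain ⟨O, hO, hxO, φ, hφ, hφ', hMO⟩ := hM (tau (f x)) hx.2
  have himage : f '' (f ⁻¹' V') = V' ∩ range f := image_preimage_eq_inter_range
  have hiff : ∀ w ∈ V ∩ V', (w ∈ range f ↔ tau w ∈ M) := by
    intro w hw
    have h1 : w ∈ V' ∩ range f ↔ w ∈ V ∩ tau ⁻¹' M := by rw [← himage, hUV]
    exact ⟨fun h => (h1.1 ⟨hw.2, h⟩).2, fun h => (h1.2 ⟨hw.1, h⟩).2⟩
  -- τ is open, so τ(V ∩ V') is a neighbourhood of τ(f(x)). On it τ(range f) coincides with M: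
  -- membership of a base point can be tested at any point above it, as the image is a union of
  -- fibres.
  refine ⟨O ∩ tau '' (V ∩ V'), hO.inter (isOpenMap_tau _ (hV.inter hV')),
    ⟨hxO, mem_image_of_mem _ ⟨hx.1, hxU⟩⟩, φ, hφ.mono inter_subset_left, fun z hz => hφ' z hz.1, ?_⟩
  ext z
  constructor
  · rintro ⟨hz, hzO, ⟨w, hw, rfl⟩⟩
    refine ⟨⟨hzO, mem_image_of_mem _ hw⟩, ?_⟩
    have h1 : w ∈ range f := by
      rw [hfull]
      exact hz
    have h2 : tau w ∈ M ∩ O := ⟨(hiff w hw).1 h1, hzO⟩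
    rw [hMO] at h2
    exact h2.2
  · rintro ⟨⟨hzO, ⟨w, hw, rfl⟩⟩, h0⟩
    have h2 : tau w ∈ M ∩ O := by
      rw [hMO]
      exact ⟨hzO, h0⟩
    exact ⟨mem_image_of_mem _ ((hiff w hw).2 h2.1), hzO, mem_image_of_mem _ hw⟩

/-! ### Non-integrability of the horizontal distribution -/

/-- The holomorphic contact form: `contact p v = ⟪j p, v⟫`. -/
noncomputable def contact (p v : C4) : ℂ := p 0 * v 1 - p 1 * v 0 + p 2 * v 3 - p 3 * v 2

lemma contact_eq_inner (p v : C4) : contact p v = ⟪jMul p, v⟫_ℂ := by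
  simp [contact, PiLp.inner_apply, Fin.sum_univ_four, jMul]
  ring

lemma contact_comm (p v : C4) : contact v p = -contact p v := by
  simp only [contact]
  ring

lemma contact_self (p : C4) : contact p p = 0 := by
  simp only [contact]
  ring

lemma contact_add_left (p q v : C4) : contact (p + q) v = contact p v + contact q v := by
  simp only [contact, PiLp.add_apply]
  ring

lemma contact_add_right (p v w : C4) : contact p (v + w) = contact p v + contact p w := by
  simp only [contact, PiLp.add_apply]
  ring

lemma contact_smul_left (c : ℂ) (p v : C4) : contact (c • p) v = c * contact p v := by
  simp only [contact, PiLp.smul_apply, smul_eq_mul]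
  ring

lemma contact_smul_right (c : ℂ) (p v : C4) : contact p (c • v) = c * contact p v := by
  simp only [contact, PiLp.smul_apply, smul_eq_mul]
  ring

/-- Taking p = v gives |v|²: this is the nondegeneracy of the complex symplectic form. -/
lemma contact_jMul_right (p v : C4) : contact p (jMul v) = ⟪v, p⟫_ℂ := by
  simp [contact, PiLp.inner_apply, Fin.sum_univ_four, jMul]

lemma hasDerivAt_contact {F G : ℝ → C4} {F' G' : C4} {t : ℝ} (hF : HasDerivAt F F' t)
    (hG : HasDerivAt G G' t) :
    HasDerivAt (fun s => contact (F s) (G s)) (contact F' (G t) + contact (F t) G') t := by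
  have hc : ∀ {F : ℝ → C4} {F' : C4}, HasDerivAt F F' t →
      ∀ k : Fin 4, HasDerivAt (fun s => F s k) (F' k) t := fun {F F'} h k =>
    (((EuclideanSpace.proj (𝕜 := ℂ) k : C4 →L[ℂ] ℂ).restrictScalars ℝ).hasFDerivAt
      (x := F t)).comp_hasDerivAt t h
  have h := ((((hc hF 0).mul (hc hG 1)).sub ((hc hF 1).mul (hc hG 0))).add
    ((hc hF 2).mul (hc hG 3))).sub ((hc hF 3).mul (hc hG 2))
  refine HasDerivAt.congr_deriv h ?_
  simp only [contact]
  ring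

lemma inner_eq_zero_of_mem_liftD2 {p v : C4} (hv : v ∈ liftD2 p) : ⟪p, v⟫_ℂ = 0 :=
  Submodule.mem_orthogonal_singleton_iff_inner_right.1 (liftD2_le p hv)

lemma contact_eq_zero_of_mem_liftD2 {p v : C4} (hv : v ∈ liftD2 p) : contact p v = 0 := by
  have h1 : ⟪jMul p, v⟫_ℝ = 0 := hv _ (Submodule.subset_span (by simp))
  have h2 : ⟪kMul p, v⟫_ℝ = 0 := hv _ (Submodule.subset_span (by simp))
  rw [inner_real_eq] at h1 h2
  have h3 : kMul p = Complex.I • jMul p := rfl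
  rw [h3, inner_smul_left] at h2
  rw [contact_eq_inner]
  apply Complex.ext
  · simpa using h1
  · simpa using h2

lemma mem_liftD2_of_contact_eq_zero {p v : C4} (hp : ⟪p, v⟫_ℂ = 0) (hv : contact p v = 0) :
    v ∈ liftD2 p := by
  rw [contact_eq_inner] at hv
  rw [liftD2, Submodule.mem_orthogonal]
  intro w hw
  induction hw using Submodule.span_induction with
  | mem w hw =>
    have h1 : iMul p = Complex.I • p := rfl
    have h2 : kMul p = Complex.I • jMul p := rfl
    rcases hw with rfl | rfl | rfl | rfl
    · rw [inner_real_eq, hp]; simp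
    · rw [inner_real_eq, h1, inner_smul_left, hp]; simp
    · rw [inner_real_eq, hv]; simp
    · rw [inner_real_eq, h2, inner_smul_left, hv]; simp
  | zero => simp
  | add _ _ _ _ h1 h2 => rw [inner_add_left, h1, h2, add_zero]
  | smul c _ _ h1 => rw [inner_smul_left, h1, mul_zero]

/-- Vectors with the same projection differ by a multiple of p, on which the skew form `contact p`
vanishes; v may thus be replaced by its horizontal part. -/
lemma dHopf_mem_D2_iff (x : CP3) (v : C4) : dHopf x v ∈ D2 x ↔ contact (unitRep x) v = 0 := by
  set q := unitRep x
  have hsub : ∀ w, dHopf x w = dHopf x v → contact q w = contact q v := by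
    intro w hw
    have h1 : dproj q (w - v) = 0 := by
      rw [map_sub, sub_eq_zero]
      exact hw
    rw [dproj_eq_zero_iff q (unitRep_ne_zero x), Submodule.mem_span_singleton] at h1
    obtain ⟨c, hc⟩ := h1
    have h2 : w = c • q + v := by rw [hc, sub_add_cancel]
    rw [h2, contact_add_right, contact_smul_right, contact_self, mul_zero, zero_add]
  constructor
  · rintro ⟨w, hw, hwv⟩
    rw [← hsub w hwv]
    exact contact_eq_zero_of_mem_liftD2 hw
  · intro h
    set w := hopfLift x (dHopf x v)
    have h1 : dHopf x w = dHopf x v := dHopf_hopfLift x _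
    have h2 : ⟪q, w⟫_ℂ = 0 :=
      Submodule.mem_orthogonal_singleton_iff_inner_right.1 (hopfLift_mem x (dHopf x v))
    rw [← h1]
    exact Submodule.mem_map_of_mem (mem_liftD2_of_contact_eq_zero h2 ((hsub w h1).trans h))

lemma exists_unitRep_eq_smul {x : CP3} {p : C4} (hp : p ≠ 0) (hx : proj p = x) :
    ∃ c : ℂ, c ≠ 0 ∧ unitRep x = c • p := by
  have h := proj_unitRep x
  rw [← hx, proj_of_ne (unitRep_ne_zero _), proj_of_ne hp, Projectivization.mk_eq_mk_iff'] at h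
  obtain ⟨c, hc⟩ := h
  rw [← proj_of_ne hp, hx] at hc
  refine ⟨c, ?_, hc.symm⟩
  rintro rfl
  rw [zero_smul] at hc
  exact unitRep_ne_zero x hc.symm

/-- Rescaling p and v by c multiplies `contact p v` by c², so its vanishing can be tested at any
nonzero representative. This permits local lifts that are not of unit length. -/
lemma dproj_mem_D2_iff {x : CP3} {p : C4} (hp : p ≠ 0) (hx : proj p = x) (v : C4) :
    (dproj p v : T x) ∈ D2 x ↔ contact p v = 0 := by
  obtain ⟨c, hc, h⟩ := exists_unitRep_eq_smul hp hx
  have h1 : dHopf x (c • v) = dproj p v := by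
    change dproj (unitRep x) (c • v) = dproj p v
    rw [h, dproj_smul c hc p hp]
  have h2 : (dproj p v : T x) ∈ D2 x ↔ dHopf x (c • v) ∈ D2 x :=
    iff_of_eq (congrArg (fun Y : T x => Y ∈ D2 x) h1.symm)
  refine h2.trans ?_
  rw [dHopf_mem_D2_iff, h, contact_smul_left, contact_smul_right]
  simp [hc]

section Calculus

variable {A : Type*} [NormedAddCommGroup A] [NormedSpace ℝ A]

lemma hasDerivAt_comp_line {B : Type*} [NormedAddCommGroup B] [NormedSpace ℝ B] {G : A → B}
    {G' : A →L[ℝ] B} {a : A} (hG : HasFDerivAt G G' a) (u : A) :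
    HasDerivAt (fun t : ℝ => G (a + t • u)) (G' u) 0 := by
  have hline : HasDerivAt (fun t : ℝ => a + t • u) u 0 := by
    simpa using ((hasDerivAt_id (0 : ℝ)).smul_const u).const_add a
  have h0 : a + (0 : ℝ) • u = a := by simp
  rw [← h0] at hG
  exact hG.comp_hasDerivAt (0 : ℝ) hline

/-- If the pull-back of the contact form by `F` takes values in a real line at each point, then so
does its exterior derivative on the kernel. -/
lemma im_contact_mul_conj_eq_zero {F : A → C4} {Ω : Set A} (hΩ : IsOpen Ω)
    (hF : ContDiffOn ℝ ∞ F Ω) {a : A} (ha : a ∈ Ω)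
    (h : ∀ x ∈ Ω, ∀ v w, (contact (F x) (fderiv ℝ F x v) *
      star (contact (F x) (fderiv ℝ F x w))).im = 0) {u v : A}
    (hu : contact (F a) (fderiv ℝ F a u) = 0) (hv : contact (F a) (fderiv ℝ F a v) = 0) (w : A) :
    (contact (fderiv ℝ F a u) (fderiv ℝ F a v) *
      star (contact (F a) (fderiv ℝ F a w))).im = 0 := by
  have hFa := hF.contDiffAt (hΩ.mem_nhds ha)
  have hd : HasFDerivAt F (fderiv ℝ F a) a := (hFa.differentiableAt (by simp)).hasFDerivAt
  have hdd : HasFDerivAt (fderiv ℝ F) (fderiv ℝ (fderiv ℝ F) a) a :=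
    ((hFa.fderiv_right (m := ∞) (by simp)).differentiableAt (by simp)).hasFDerivAt
  have hsymm : fderiv ℝ (fderiv ℝ F) a u v = fderiv ℝ (fderiv ℝ F) a v u :=
    hFa.isSymmSndFDerivAt (by
      rw [minSmoothness_of_isRCLikeNormedField]
      exact WithTop.coe_le_coe.2 (le_top (a := (2 : ℕ∞)))) u v
  -- The identity in `h` is differentiated at a in the direction u. Where the form vanishes on v,
  -- the derivative of the conjugated factor drops out.
  have key : ∀ u v, contact (F a) (fderiv ℝ F a v) = 0 →
      ((contact (fderiv ℝ F a u) (fderiv ℝ F a v) +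
        contact (F a) (fderiv ℝ (fderiv ℝ F) a u v)) *
        star (contact (F a) (fderiv ℝ F a w))).im = 0 := by
    intro u v hv
    have h0 : a + (0 : ℝ) • u = a := by simp
    have h1 : HasDerivAt (fun t : ℝ => F (a + t • u)) (fderiv ℝ F a u) 0 :=
      hasDerivAt_comp_line hd u
    have h2 : ∀ v, HasDerivAt (fun t : ℝ => fderiv ℝ F (a + t • u) v)
        (fderiv ℝ (fderiv ℝ F) a u v) 0 := fun v =>
      hasDerivAt_comp_line ((ContinuousLinearMap.apply ℝ C4 v).hasFDerivAt.comp a hdd) u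
    have h3 := hasDerivAt_contact h1 (h2 v)
    have h4 := hasDerivAt_contact h1 (h2 w)
    have h5 := h3.mul h4.star
    have h6 := Complex.imCLM.hasFDerivAt.comp_hasDerivAt (0 : ℝ) h5
    have hev : ∀ᶠ t : ℝ in 𝓝 0, a + t • u ∈ Ω := by
      have hc : ContinuousAt (fun t : ℝ => a + t • u) 0 := by fun_prop
      exact hc.eventually (hΩ.mem_nhds (h0.symm ▸ ha : a + (0 : ℝ) • u ∈ Ω))
    have h7 : (fun _ : ℝ => (0 : ℝ)) =ᶠ[𝓝 0] Complex.imCLM ∘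
        ((fun t : ℝ => contact (F (a + t • u)) (fderiv ℝ F (a + t • u) v)) *
        fun t : ℝ => star (contact (F (a + t • u)) (fderiv ℝ F (a + t • u) w))) := by
      filter_upwards [hev] with t ht
      exact (h _ ht v w).symm
    have h8 := (h6.congr_of_eventuallyEq h7).unique (hasDerivAt_const (0 : ℝ) (0 : ℝ))
    rw [h0, hv, zero_mul, add_zero] at h8
    exact h8
  -- In the difference of the two identities the second derivatives of F cancel by symmetry, while
  -- the skew form is doubled.
  have e1 := key u v hv
  have e2 := key v u hu
  rw [hsymm] at e1
  rw [contact_comm (fderiv ℝ F a u) (fderiv ℝ F a v)] at e2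
  simp only [add_mul, neg_mul, Complex.add_im, Complex.neg_im] at e1 e2
  linarith

end Calculus

section Nonintegrable

variable {H : Type*} [TopologicalSpace H] [ChartedSpace (EuclideanSpace ℝ (Fin 5)) H]
  {f : H → CP3}

/-- A hypersurface cannot be tangent to `𝒟₂⁴` on a non-empty open set. -/
lemma not_D2_le_tangent_of_isOpen [IsManifold (𝓡 5) ∞ H] (hf : IsHypersurface f) {W : Set H}
    (hW : IsOpen W) {x₀ : H} (hx₀ : x₀ ∈ W) : ¬ ∀ x ∈ W, D2 (f x) ≤ tangent f x := by
  intro hD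
  set e := extChartAt (𝓡 5) x₀
  have hx₀s : x₀ ∈ e.source := mem_extChartAt_source x₀
  obtain ⟨i, hi⟩ := exists_mem_affineDomain (f x₀)
  let W' : Set H := W ∩ f ⁻¹' affineDomain i
  have hW' : IsOpen W' := hW.inter ((isOpen_affineDomain i).preimage hf.contMDiff.continuous)
  let Ω := e.target ∩ e.symm ⁻¹' W'
  have hΩ : IsOpen Ω := (continuousOn_extChartAt_symm x₀).isOpen_inter_preimage
    (isOpen_extChartAt_target x₀) hW'
  -- A local lift of the hypersurface to ℂ⁴ ∖ {0}, through the affine section of the projection.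
  let F : EuclideanSpace ℝ (Fin 5) → C4 := fun u => unaffine i (affineChart i (f (e.symm u)))
  have hF : ContDiffOn ℝ ∞ F Ω := by
    refine (contDiff_unaffine i).comp_contDiffOn ?_
    rw [← contMDiffOn_iff_contDiffOn]
    refine (contMDiffOn_of_mem_maximalAtlas (I := 𝓘(ℝ, C3)) (n := ∞)
      (IsManifold.subset_maximalAtlas (mem_range_self i))).comp (hf.contMDiff.comp_contMDiffOn
      ((contMDiffOn_extChartAt_symm x₀).mono inter_subset_left)) ?_
    exact fun u hu => hu.2.2
  have hF0 : ∀ u, F u ≠ 0 := fun u => unaffine_ne_zero i _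
  have hFe : ∀ x ∈ W', x ∈ e.source → proj (F (e x)) = f x := by
    intro x hx hxs
    have h1 : F (e x) = unaffine i (affineChart i (f x)) := by
      simp only [F, e.left_inv hxs]
    rw [h1, proj_of_ne (unaffine_ne_zero i _)]
    exact (affineChart i).left_inv hx.2
  have hmem : ∀ x ∈ W', x ∈ e.source → e x ∈ Ω := fun x hx hxs =>
    ⟨e.map_source hxs, by rwa [mem_preimage, e.left_inv hxs]⟩
  have hdF : ∀ x ∈ W', x ∈ e.source → ∀ v : TangentSpace (𝓡 5) x,
      (dproj (F (e x)) (fderiv ℝ F (e x)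
        (mfderiv (𝓡 5) 𝓘(ℝ, EuclideanSpace ℝ (Fin 5)) e x v)) : T (f x)) =
      mfderiv (𝓡 5) 𝓘(ℝ, C3) f x v := by
    intro x hx hxs v
    have h1 : HasFDerivAt F (fderiv ℝ F (e x)) (e x) :=
      ((hF.contDiffAt (hΩ.mem_nhds (hmem x hx hxs))).differentiableAt (by simp)).hasFDerivAt
    have h2 := HasMFDerivAt.comp x h1.hasMFDerivAt
      (mdifferentiableAt_extChartAt_of_mem hxs).hasMFDerivAt
    have h3 := HasMFDerivAt.comp x (hasMFDerivAt_proj (hF0 (e x))) h2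
    have h4 : f =ᶠ[𝓝 x] proj ∘ F ∘ e := by
      filter_upwards [hW'.mem_nhds hx, (isOpen_extChartAt_source (I := 𝓡 5) x₀).mem_nhds hxs]
        with z hz hz'
      exact (hFe z hz hz').symm
    have h5 := h3.congr_of_eventuallyEq h4
    rw [h5.mfderiv]
    rfl
  have hpt : ∀ u ∈ Ω, ∃ x ∈ W', x ∈ e.source ∧ u = e x := fun u hu =>
    ⟨e.symm u, hu.2, e.map_target hu.1, (e.right_inv hu.1).symm⟩
  let α : EuclideanSpace ℝ (Fin 5) → EuclideanSpace ℝ (Fin 5) →ₗ[ℝ] ℂ := fun u =>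
    { toFun := fun v => contact (F u) (fderiv ℝ F u v)
      map_add' := fun v w => by rw [map_add, contact_add_right]
      map_smul' := fun c v => by
        rw [map_smul, RingHom.id_apply, Complex.real_smul, ← contact_smul_right]
        rfl }
  -- The kernel of the pulled-back form is the preimage of `D2`. Since `D2` is tangent, this has
  -- dimension 4 in a space of dimension 5.
  have hrank : ∀ u ∈ Ω, finrank ℝ (LinearMap.range (α u)) = 1 := by
    intro u hu
    obtain ⟨x, hx, hxs, rfl⟩ := hpt u hu
    let D : TangentSpace (𝓡 5) x →ₗ[ℝ] ℂ := α (e x) ∘ₗ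
      (mfderiv (𝓡 5) 𝓘(ℝ, EuclideanSpace ℝ (Fin 5)) e x).toLinearMap
    have hrange : LinearMap.range D = LinearMap.range (α (e x)) :=
      LinearMap.range_comp_of_range_eq_top _
        (LinearMap.range_eq_top.2 (bijective_mfderiv_extChartAt hxs).2)
    have hker : LinearMap.ker D =
        (D2 (f x)).comap (mfderiv (𝓡 5) 𝓘(ℝ, C3) f x).toLinearMap := by
      ext v
      rw [LinearMap.mem_ker, Submodule.mem_comap]
      have h1 := dproj_mem_D2_iff (hF0 (e x)) (hFe x hx hxs) (fderiv ℝ F (e x)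
        (mfderiv (𝓡 5) 𝓘(ℝ, EuclideanSpace ℝ (Fin 5)) e x v))
      rw [hdF x hx hxs v] at h1
      exact h1.symm
    have hkd : finrank ℝ (LinearMap.ker D) = 4 := by
      have h1 : (LinearMap.ker D).map (mfderiv (𝓡 5) 𝓘(ℝ, C3) f x).toLinearMap = D2 (f x) := by
        rw [hker, Submodule.map_comap_eq]
        exact inf_eq_right.2 (hD x hx.1)
      rw [← finrank_D2 (f x), ← h1]
      exact (LinearEquiv.finrank_eq (Submodule.equivMapOfInjective _
        (hf.injective_mfderiv x) _))
    have h2 := D.finrank_range_add_finrank_ker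
    have h3 : finrank ℝ (TangentSpace (𝓡 5) x) = 5 := by
      change finrank ℝ (EuclideanSpace ℝ (Fin 5)) = 5
      simp
    rw [← hrange]
    omega
  have him : ∀ u ∈ Ω, ∀ v w, (contact (F u) (fderiv ℝ F u v) *
      star (contact (F u) (fderiv ℝ F u w))).im = 0 := by
    intro u hu v w
    obtain ⟨z, hz⟩ := finrank_le_one_iff.1 (hrank u hu).le
    obtain ⟨r, hr⟩ := hz ⟨α u v, v, rfl⟩
    obtain ⟨s, hs⟩ := hz ⟨α u w, w, rfl⟩
    have h1 : contact (F u) (fderiv ℝ F u v) = r • (z : ℂ) := (congrArg Subtype.val hr).symm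
    have h2 : contact (F u) (fderiv ℝ F u w) = s • (z : ℂ) := (congrArg Subtype.val hs).symm
    rw [h1, h2]
    simp
    ring
  set a := e x₀
  have hx₀W : x₀ ∈ W' := ⟨hx₀, hi⟩
  have ha : a ∈ Ω := hmem x₀ hx₀W hx₀s
  obtain ⟨w, hw⟩ : ∃ w, contact (F a) (fderiv ℝ F a w) ≠ 0 := by
    by_contra! h
    have h0 : α a = 0 := LinearMap.ext h
    have h1 := hrank a ha
    rw [h0, LinearMap.range_zero, finrank_bot] at h1
    exact zero_ne_one h1
  have hne : D2 (f x₀) ≠ ⊥ := by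
    intro h
    have h1 := finrank_D2 (f x₀)
    rw [h, finrank_bot] at h1
    exact absurd h1 (by norm_num)
  -- A nonzero horizontal lift y in `liftD2`. Then y, iy and jy all lie in the kernel of the contact
  -- form at F(a).
  obtain ⟨_, ⟨y, hy, rfl⟩, hy0⟩ := Submodule.exists_mem_ne_zero_of_ne_bot hne
  have hy0' : y ≠ 0 := by
    rintro rfl
    exact hy0 (map_zero _)
  obtain ⟨c, hc, hcF⟩ := exists_unitRep_eq_smul (hF0 a) (hFe x₀ hx₀W hx₀s)
  have hy1 : contact (F a) y = 0 := by
    have h1 := contact_eq_zero_of_mem_liftD2 hy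
    rw [hcF, contact_smul_left] at h1
    exact (mul_eq_zero.1 h1).resolve_left hc
  have hy2 : contact (F a) (jMul y) = 0 := by
    have h1 := inner_eq_zero_of_mem_liftD2 hy
    rw [hcF, inner_smul_left] at h1
    have h2 := (mul_eq_zero.1 h1).resolve_left (by simpa using hc)
    rw [contact_jMul_right, inner_eq_zero_symm]
    exact h2
  -- Every kernel vector is tangent to the lift up to a multiple of F(a); by `hval` below, such
  -- multiples do not affect the values of the symplectic form used here.
  have hlift : ∀ q, contact (F a) q = 0 →
      ∃ v, contact (F a) (fderiv ℝ F a v) = 0 ∧ ∃ l : ℂ, fderiv ℝ F a v = q + l • F a := by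
    intro q hq
    obtain ⟨v, hv⟩ := hD x₀ hx₀ ((dproj_mem_D2_iff (hF0 a) (hFe x₀ hx₀W hx₀s) q).2 hq)
    have h1 := (hdF x₀ hx₀W hx₀s v).trans hv
    have h2 : dproj (F a) (fderiv ℝ F a
        (mfderiv (𝓡 5) 𝓘(ℝ, EuclideanSpace ℝ (Fin 5)) e x₀ v) - q) = 0 := by
      rw [map_sub, sub_eq_zero]
      exact h1
    rw [dproj_eq_zero_iff _ (hF0 a), Submodule.mem_span_singleton] at h2
    obtain ⟨l, hl⟩ := h2
    have h3 : fderiv ℝ F a (mfderiv (𝓡 5) 𝓘(ℝ, EuclideanSpace ℝ (Fin 5)) e x₀ v) =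
        q + l • F a := by rw [hl, add_sub_cancel]
    refine ⟨_, ?_, l, h3⟩
    rw [h3, contact_add_right, hq, contact_smul_right, contact_self, mul_zero, add_zero]
  obtain ⟨u, hu, l, hul⟩ := hlift y hy1
  obtain ⟨u', hu', l', hul'⟩ := hlift (Complex.I • y)
    (by rw [contact_smul_right, hy1, mul_zero])
  obtain ⟨v, hv, m, hvm⟩ := hlift (jMul y) hy2
  have e1 := im_contact_mul_conj_eq_zero hΩ hF ha him hu hv w
  have e2 := im_contact_mul_conj_eq_zero hΩ hF ha him hu' hv w
  have hval : ∀ (q : C4) (l : ℂ), contact (F a) q = 0 →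
      contact (q + l • F a) (jMul y + m • F a) = contact q (jMul y) := by
    intro q l hq
    rw [contact_add_left, contact_add_right, contact_add_right, contact_smul_left,
      contact_smul_left, contact_smul_right, contact_smul_right, contact_self, hy2,
      contact_comm (F a) q, hq]
    ring
  rw [hul, hvm, hval y l hy1] at e1
  rw [hul', hvm, hval _ l' (by rw [contact_smul_right, hy1, mul_zero]), contact_smul_left,
    mul_assoc] at e2
  -- The pair (y, jy) kills the imaginary part of this product, and (iy, jy) kills the imaginary
  -- part of i times it, which is its real part.
  have h0 : contact y (jMul y) * star (contact (F a) (fderiv ℝ F a w)) = 0 := by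
    apply Complex.ext
    · simpa using e2
    · exact e1
  rcases mul_eq_zero.1 h0 with h1 | h1
  · rw [contact_jMul_right, inner_self_eq_zero] at h1
    exact hy0' h1
  · exact hw (star_eq_zero.1 h1)

/-- The tangent space maps onto the base exactly when it spans everything together with ker dτ =
`D1`. For a hyperplane this means that it does not contain `D1`. -/
lemma surjective_mfderiv_tau_comp_iff (hf : IsHypersurface f) (x : H) :
    Surjective (mfderiv (𝓡 5) (𝓡 4) (tau ∘ f) x) ↔ ¬ D1 (f x) ≤ tangent f x := by
  have hd : mfderiv (𝓡 5) (𝓡 4) (tau ∘ f) x =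
      (mfderiv 𝓘(ℝ, C3) (𝓡 4) tau (f x)).comp (mfderiv (𝓡 5) 𝓘(ℝ, C3) f x) :=
    mfderiv_comp x ((contMDiff_tau (f x)).mdifferentiableAt (by simp))
      ((hf.contMDiff x).mdifferentiableAt (by simp))
  let τ' : T (f x) →ₗ[ℝ] EuclideanSpace ℝ (Fin 4) :=
    (mfderiv 𝓘(ℝ, C3) (𝓡 4) tau (f x) : T (f x) →L[ℝ] TangentSpace (𝓡 4) (tau (f x))).toLinearMap
  have hker : LinearMap.ker τ' = D1 (f x) := by
    ext X
    exact mfderiv_tau_eq_zero_iff (f x) X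
  have hsurj : Surjective τ' := surjective_mfderiv_tau (f x)
  have h1 : Surjective (mfderiv (𝓡 5) (𝓡 4) (tau ∘ f) x) ↔ (tangent f x).map τ' = ⊤ := by
    have h2 : (tangent f x).map τ' =
        LinearMap.range (τ' ∘ₗ (mfderiv (𝓡 5) 𝓘(ℝ, C3) f x).toLinearMap) :=
      (LinearMap.range_comp _ _).symm
    rw [h2, LinearMap.range_eq_top, hd]
    rfl
  have h3 : (tangent f x).map τ' = ⊤ ↔ tangent f x ⊔ D1 (f x) = ⊤ := by
    rw [← hker]
    exact LinearMap.map_eq_top_iff (LinearMap.range_eq_top.2 hsurj)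
  rw [h1, h3]
  constructor
  · intro h hle
    rw [sup_eq_left.2 hle] at h
    have h4 := finrank_tangent hf x
    rw [h, finrank_top, finrank_T] at h4
    exact absurd h4 (by norm_num)
  · intro h
    have hlt : tangent f x < tangent f x ⊔ D1 (f x) :=
      lt_of_le_of_ne le_sup_left fun h' => h (sup_eq_left.1 h'.symm)
    have h4 := Submodule.finrank_lt_finrank_of_lt hlt
    have h5 := Submodule.finrank_le (tangent f x ⊔ D1 (f x))
    rw [finrank_tangent hf] at h4
    rw [finrank_T] at h5
    exact Submodule.eq_top_of_finrank_eq (by rw [finrank_T]; omega)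

/-- If each tangent space contains one of the distributions, then each contains `𝒟₁²`. -/
lemma D1_le_tangent_of_containsDistribution [IsManifold (𝓡 5) ∞ H]
    (hf : IsHypersurface f) (h : ContainsDistribution f)
    (x : H) : D1 (f x) ≤ tangent f x := by
  by_contra hx
  -- Being a submersion is an open condition, so one point where `D1` is not tangent gives an open
  -- set of them, on which `D2` must be tangent.
  have hopen : IsOpen {x | Surjective (mfderiv (𝓡 5) (𝓡 4) (tau ∘ f) x)} :=
    isOpen_setOf_surjective_mfderiv (contMDiff_tau.comp hf.contMDiff)
  refine not_D2_le_tangent_of_isOpen hf hopen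
    ((surjective_mfderiv_tau_comp_iff hf x).2 hx) fun z hz => ?_
  exact (h z).resolve_left ((surjective_mfderiv_tau_comp_iff hf z).1 hz)

lemma containsDistribution_iff_isHorizontal [IsManifold (𝓡 5) ∞ H]
    (hf : IsHypersurface f) :
    ContainsDistribution f ↔ IsHorizontal f := by
  rw [isHorizontal_iff hf]
  exact ⟨D1_le_tangent_of_containsDistribution hf, fun h x => Or.inl (h x)⟩

lemma isLocallyPreimage_iff_isHorizontal [IsManifold (𝓡 5) ∞ H]
    (hf : IsHypersurface f) :
    IsLocallyPreimage f ↔ IsHorizontal f := by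
  rw [isHorizontal_iff hf]
  refine ⟨fun h x => ?_, isLocallyPreimage_of_D1_le hf⟩
  obtain ⟨U, hU, hxU, V, -, M, hM, hUV⟩ := h x
  exact D1_le_tangent_of_subset_preimage hf hU hxU hM (hUV.trans_subset inter_subset_right)

lemma isHorizontal_of_isPreimage (hf : IsHypersurface f) (h : IsPreimage f) :
    IsHorizontal f := by
  rw [isHorizontal_iff hf]
  intro x
  obtain ⟨M, hM, hfM⟩ := h
  exact D1_le_tangent_of_subset_preimage hf isOpen_univ (mem_univ x) hM
    (by rw [image_univ, hfM])

end Nonintegrable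

end NKCP3

theorem mainTheorem8 {H : Type*} [TopologicalSpace H]
    [ChartedSpace (EuclideanSpace ℝ (Fin 5)) H] [IsManifold (𝓡 5) ∞ H]
    (f : H → NKCP3.CP3) (hf : NKCP3.IsHypersurface f) :
    List.TFAE [NKCP3.IsHorizontal f, NKCP3.HasTwoDimSpan f, NKCP3.IsPInvariant f,
      NKCP3.IsPInvariantLine f, NKCP3.IsLocallyPreimage f] ∧
    (NKCP3.IsPreimage f → NKCP3.IsHorizontal f) ∧
    (Topology.IsEmbedding f →
      (∀ y : NKCP3.S4, IsClosed (Set.range f ∩ NKCP3.tau ⁻¹' {y})) →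
      (NKCP3.IsHorizontal f → NKCP3.IsPreimage f)) := by
  refine ⟨?_, NKCP3.isHorizontal_of_isPreimage hf, fun hemb hclosed h =>
    NKCP3.isPreimage_of_isLocallyPreimage
      ((NKCP3.isLocallyPreimage_iff_isHorizontal hf).2 h) hemb hclosed⟩
  have h := NKCP3.containsDistribution_iff_isHorizontal hf
  tfae_have 2 ↔ 1 := (NKCP3.hasTwoDimSpan_iff hf).trans h
  tfae_have 3 ↔ 1 := (NKCP3.isPInvariant_iff hf).trans h
  tfae_have 4 ↔ 1 := (NKCP3.isPInvariantLine_iff hf).trans h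
  tfae_have 5 ↔ 1 := NKCP3.isLocallyPreimage_iff_isHorizontal hf
  tfae_finish
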